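/- **Notation.** Scalars are real or complex. For a countable ordinal $\alpha$, $C(\omega^\alpha)$ is the Banach space of continuous functions on the ordinal interval $[1,\omega^\alpha]$ with the order topology and the supremum norm, and $C_0(\omega^\alpha)$ is the subspace of the functions vanishing at $\omega^\alpha$. $[A]$ denotes the closed linear span of $A$, and bases are Schauder bases. Two sequences $(x_n)$, $(z_n)$ are $C$-equivalent if $x_n\mapsto z_n$ extends to an isomorphism $R:[x_n]\to[z_n]$ with $\|R\|\|R^{-1}\|\le C$. **Standard bases.** For $\alpha\ge 1$, a standard basis $(x^\alpha_n)_{n\ge 0}$ of $C(\omega^\alpha)$ is defined inductively. For $\alpha=1$: $x^1_0=\mathbb 1_{(0,\omega]}$ and $x^1_n=\mathbb 1_{\{n\}}$ for $1\le n<\omega$. For $\alpha=\gamma+1$: take a standard basis $(x^\gamma_n)$ of $C(\omega^\gamma)$, and for $k\ge1$, $n\ge 0$ let $x_{k,n}$ be supported in $(\omega^\gamma(k-1),\omega^\gamma k]$ with $x_{k,n}(\rho)=x^\gamma_n(\rho-\omega^\gamma(k-1))$ there. For a limit $\alpha$: take a strictly increasing sequence $(\gamma_k)_{k\ge1}$ of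 ordinals $\geq 1$ with limit $\alpha$ and standard bases $(x^{\gamma_k}_n)_n$ of $C(\omega^{\gamma_k})$, put $a_0=0$, $a_k=\omega^{\gamma_k}$, and let $x_{k,n}$ be supported in $(a_{k-1},a_k]$ with $x_{k,n}(\rho)=x^{\gamma_k}_n(\rho-a_{k-1})$ there. In both cases $x^\alpha_0=\mathbb 1_{(0,\omega^\alpha]}$, and $(x^\alpha_j)_{j\ge1}$ is any enumeration of the $x_{k,n}$ in which $x_{k,n}$ precedes $x_{k,n'}$ whenever $n<n'$. A standard basis of $C_0(\omega^\alpha)$ is $(x^\alpha_n)_{n\ge1}$ for any such choices. **The game.** Let $(x_n)_{n\ge1}$ be a basis of a Banach space $X$, $T$ an isomorphic embedding of $X$ into a Banach space $Y$ with a basis $(y_i)_{i\ge1}$, $T^{-1}$ its inverse $T(X)\to X$, and $(\epsilon_k)_{k\ge0}$ positive numbers. Put $l_0=0$, $G_0=\emptyset$, $M_0=\emptyset$. On turn $k\ge1$ the first player chooses an integer $i_k\ge l_{k-1}$, finitely many $u^k_n\in Y^*$ and $\rho^k_n>0$ ($n\in F_k$), and finitely many vectors $(b_j)_{j\in J_k}$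 in $[y_i:l_{k-1}<i\le i_k]$ such that $|v^{k-1}_n(b)|<\delta^{k-1}_n\|b\|$ for all nonzero $b\in[b_j:j\in J_k]$ and all $n\in G_{k-1}$. The second player then chooses an integer $l_k>i_k$, a nonempty finite set $M_k\subset\mathbb N$ with $\max M_{k-1}<\min M_k$ (if $k\geq 2$), nonzero successive blocks $(w_m)_{m\in M_k}$ of the basis $(y_i)$ lying in $[y_i:i_k<i\le l_k]$ with $\sum_{m\in M_k}\|Tx_m-w_m\|<\epsilon_k$, where also $|u^k_n(x)|<\rho^k_n\|x\|$ must hold for all nonzero $x\in[Tx_m:m\in M_k]$ and all $n\in F_k$; and finitely many $v^k_n\in Y^*$ and $\delta^k_n>0$ ($n\in G_k$). With $M=\bigcup_k M_k$, the second player wins if 1. $(x_m)_{m\in M}$ is $C$-equivalent to $(x_n)_{n\ge1}$, and 2. there is a projection $P$ of norm at most $D\|T\|\|T^{-1}\|$ from $[\{b_j:j\in J_k,k\in\mathbb N\}\cup\{Tx_m:m\in M\}]$ onto $[Tx_m:m\in M]$ with $\|Pz\|\le\epsilon_0\|z\|$ for all $z\in[b_j:j\in J_k,k\in\mathbb N]$.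 The basis $(x_n)$ is *two-player $D$-complementably subsequentially $C$-reproducible* if for all $Y$, $(y_i)$, $T$ and $(\epsilon_k)$ as above the second player has a winning strategy in this game. **Proposition.** Let $\alpha$ be a countable ordinal. Every standard basis of $C_0(\omega^\alpha)$ is a basis of $C_0(\omega^\alpha)$ that is two-player $2$-complementably subsequentially $1$-reproducible. (For $\alpha=0$ there is no standard basis and nothing is claimed.) -/

import Mathlib

universe u v w

noncomputable section

open Ordinal in
/-- The interval `[1, ω ^ α]` of ordinals, with its order topology; it is compact. -/
abbrev OrdInterval (α : Ordinal.{0}) : Type 1 :=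
  Set.Icc (1 : Ordinal.{0}) (ω ^ α)

open Ordinal in
/-- `C₀(ω ^ α)`: the continuous scalar functions on `[1, ω ^ α]` that vanish at `ω ^ α`, as a
closed subspace of `C([1, ω ^ α])` with the supremum norm. -/
def C0 (𝕜 : Type u) [RCLike 𝕜] (α : Ordinal.{0}) : Submodule 𝕜 C(OrdInterval α, 𝕜) where
  carrier := {f | ∀ ρ : OrdInterval α, (ρ : Ordinal.{0}) = ω ^ α → f ρ = 0}
  add_mem' := by
    intro f g hf hg ρ hρ
    simp [hf ρ hρ, hg ρ hρ]
  zero_mem' := by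
    intro ρ _
    rfl
  smul_mem' := by
    intro c f hf ρ hρ
    simp [hf ρ hρ]

/-- One inductive step in the construction of standard bases. The interval `(0, top]` is cut by the
points `a 0 < a 1 < ...` and `f k n` is the `n`-th function of the `k`-th piece. The new
sequence starts with the indicator function of `(0, top]`; its member of index `j + 1` is, for
`e j = (k, n)`, the copy of `f k n` that is moved to `(a k, a (k + 1)]` and is zero elsewhere. -/
def assemble (𝕜 : Type u) [RCLike 𝕜] (top : Ordinal.{0}) (a : ℕ → Ordinal.{0})
    (f : ℕ → ℕ → Ordinal.{0} → 𝕜) (e : ℕ ≃ ℕ × ℕ) : ℕ → Ordinal.{0} → 𝕜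
  | 0 => Set.indicator (Set.Ioc 0 top) 1
  | j + 1 => Set.indicator (Set.Ioc (a (e j).1) (a ((e j).1 + 1)))
      (fun ρ => f (e j).1 (e j).2 (ρ - a (e j).1))

/-- An enumeration `e` of the pairs `(k, n)` (piece, place in the piece) in which every single piece
keeps its own order. -/
def IsAdmissibleOrder (e : ℕ ≃ ℕ × ℕ) : Prop :=
  ∀ j m k n n' : ℕ, e j = (k, n) → e m = (k, n') → n < n' → j < m

/-- The left end points of the pieces at a limit ordinal: `0, ω ^ γ 0, ω ^ γ 1, ...`. -/
def limitCuts (γ : ℕ → Ordinal.{0}) : ℕ → Ordinal.{0}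
  | 0 => 0
  | k + 1 => Ordinal.omega0 ^ γ k

/-- `IsStandardFamily 𝕜 α x`: the functions `x 0, x 1, ...`, extended by zero to all ordinals, form a
standard basis of `C(ω ^ α)`. All choices (of the enumeration of the pieces and of the sequence
that approximates a limit ordinal) are allowed. -/
inductive IsStandardFamily (𝕜 : Type u) [RCLike 𝕜] :
    Ordinal.{0} → (ℕ → Ordinal.{0} → 𝕜) → Prop
  | one : IsStandardFamily 𝕜 1 (fun n : ℕ =>
      if n = 0 then Set.indicator (Set.Ioc 0 Ordinal.omega0) 1
      else Set.indicator {(n : Ordinal.{0})} 1)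
  | succ (γ : Ordinal.{0}) (x : ℕ → Ordinal.{0} → 𝕜) (e : ℕ ≃ ℕ × ℕ)
      (hx : IsStandardFamily 𝕜 γ x) (he : IsAdmissibleOrder e) :
      IsStandardFamily 𝕜 (γ + 1)
        (assemble 𝕜 (Ordinal.omega0 ^ (γ + 1))
          (fun k => Ordinal.omega0 ^ γ * (k : Ordinal.{0})) (fun _ => x) e)
  | limit (γ : Ordinal.{0}) (γs : ℕ → Ordinal.{0}) (x : ℕ → ℕ → Ordinal.{0} → 𝕜) (e : ℕ ≃ ℕ × ℕ)
      (hmono : StrictMono γs) (hlim : IsLUB (Set.range γs) γ)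
      (hx : ∀ k, IsStandardFamily 𝕜 (γs k) (x k)) (he : IsAdmissibleOrder e) :
      IsStandardFamily 𝕜 γ (assemble 𝕜 (Ordinal.omega0 ^ γ) (limitCuts γs) x e)

/-- A standard basis of `C₀(ω ^ α)`: a standard basis of `C(ω ^ α)` without its first member, the
constant function. The index `n` here stands for the index `n + 1` there. -/
def IsStandardBasisC0 (𝕜 : Type u) [RCLike 𝕜] (α : Ordinal.{0}) (x : ℕ → C0 𝕜 α) : Prop :=
  ∃ f : ℕ → Ordinal.{0} → 𝕜, IsStandardFamily 𝕜 α f ∧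
    ∀ (n : ℕ) (ρ : OrdInterval α), (x n : C(OrdInterval α, 𝕜)) ρ = f (n + 1) ρ

/-- Two sequences are `C`-equivalent: the linear map that sends `x i` to `z i` is an isomorphism
between the spans with `‖R‖ * ‖R⁻¹‖ ≤ C`. -/
def CEquivalent (𝕜 : Type u) [RCLike 𝕜] {X : Type v} [NormedAddCommGroup X] [NormedSpace 𝕜 X]
    {Z : Type w} [NormedAddCommGroup Z] [NormedSpace 𝕜 Z]
    (C : ℝ) (x : ℕ → X) (z : ℕ → Z) : Prop :=
  ∃ A B : ℝ, 0 < A ∧ 0 < B ∧ A * B ≤ C ∧ ∀ (s : Finset ℕ) (a : ℕ → 𝕜),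
    ‖∑ i ∈ s, a i • z i‖ ≤ B * ‖∑ i ∈ s, a i • x i‖ ∧
    ‖∑ i ∈ s, a i • x i‖ ≤ A * ‖∑ i ∈ s, a i • z i‖

namespace ReproducibleGame

/-! The turns of the game and the members of all bases are counted from `0`; `l` stands for the
set of the first `l` members `y 0, ..., y (l - 1)` of a basis. -/

/-- The span of the members `y i` with `l ≤ i < r`. -/
def window (𝕜 : Type u) [RCLike 𝕜] {Y : Type v} [NormedAddCommGroup Y] [NormedSpace 𝕜 Y]
    (y : SchauderBasis 𝕜 Y) (l r : ℕ) : Submodule 𝕜 Y :=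
  Submodule.span 𝕜 (y.basis '' Set.Ico l r)

/-- All nonzero `v` in `V` satisfy `|u v| < δ ‖v‖` for each condition `(u, δ)` in `G`. -/
def Small {𝕜 : Type u} [RCLike 𝕜] {Y : Type v} [NormedAddCommGroup Y] [NormedSpace 𝕜 Y]
    (G : Finset (StrongDual 𝕜 Y × ℝ)) (V : Submodule 𝕜 Y) : Prop :=
  ∀ c ∈ G, ∀ v ∈ V, v ≠ 0 → ‖c.1 v‖ < c.2 * ‖v‖

/-- What the first player chooses in one turn: an integer, finitely many functionals with positive
bounds (the conditions on the answer), and finitely many vectors `b`. -/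
structure FirstMove (𝕜 : Type u) [RCLike 𝕜] (Y : Type v) [NormedAddCommGroup Y]
    [NormedSpace 𝕜 Y] where
  i : ℕ
  F : Finset (StrongDual 𝕜 Y × ℝ)
  b : Finset Y

/-- What the second player chooses in one turn: an integer, a finite set of indices, blocks `w m`
(only those with `m ∈ M` matter), and finitely many functionals with positive bounds (the
conditions on the first player's next turn). -/
structure SecondMove (𝕜 : Type u) [RCLike 𝕜] (Y : Type v) [NormedAddCommGroup Y]
    [NormedSpace 𝕜 Y] where
  l : ℕ
  M : Finset ℕ
  w : ℕ → Y
  G : Finset (StrongDual 𝕜 Y × ℝ)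

/-- The position before the first turn: `l = 0`, and nothing else has been chosen. -/
def SecondMove.start (𝕜 : Type u) [RCLike 𝕜] (Y : Type v) [NormedAddCommGroup Y]
    [NormedSpace 𝕜 Y] : SecondMove 𝕜 Y where
  l := 0
  M := ∅
  w := 0
  G := ∅

variable {𝕜 : Type u} [RCLike 𝕜] {X : Type w} [NormedAddCommGroup X] [NormedSpace 𝕜 X]
  {Y : Type v} [NormedAddCommGroup Y] [NormedSpace 𝕜 Y]

/-- `p` is a legal move of the first player after the move `prev` of the second player. -/
def FirstLegal (y : SchauderBasis 𝕜 Y) (prev : SecondMove 𝕜 Y) (p : FirstMove 𝕜 Y) : Prop :=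
  prev.l ≤ p.i ∧
  (∀ c ∈ p.F, 0 < c.2) ∧
  (∀ b ∈ p.b, b ∈ window 𝕜 y prev.l p.i) ∧
  Small prev.G (Submodule.span 𝕜 (p.b : Set Y))

/-- `q` is a legal answer of the second player to the move `p`, after the second player's preceding
move `prev`. Here `Tx m` is the image in `Y` of the `m`-th basis vector. -/
def SecondLegal (y : SchauderBasis 𝕜 Y) (Tx : ℕ → Y) (ε : ℝ) (prev : SecondMove 𝕜 Y)
    (p : FirstMove 𝕜 Y) (q : SecondMove 𝕜 Y) : Prop :=
  p.i < q.l ∧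
  q.M.Nonempty ∧
  (∀ m ∈ prev.M, ∀ m' ∈ q.M, m < m') ∧
  (∀ m ∈ q.M, q.w m ≠ 0 ∧ q.w m ∈ window 𝕜 y p.i q.l) ∧
  (∀ m ∈ q.M, ∀ m' ∈ q.M, m < m' →
    ∃ r, q.w m ∈ window 𝕜 y p.i r ∧ q.w m' ∈ window 𝕜 y r q.l) ∧
  ∑ m ∈ q.M, ‖Tx m - q.w m‖ < ε ∧
  Small p.F (Submodule.span 𝕜 (Tx '' (q.M : Set ℕ))) ∧
  (∀ c ∈ q.G, 0 < c.2)

variable (𝕜 Y) in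
/-- A strategy of the second player gives the answer in turn `k` as a function of the first player's
moves in the turns `0, ..., k`. -/
def Strategy : Type (max u v) :=
  (k : ℕ) → (Fin (k + 1) → FirstMove 𝕜 Y) → SecondMove 𝕜 Y

/-- The answer in turn `k` if the first player plays `p` and the second player follows `σ`. -/
def Strategy.answer (σ : Strategy 𝕜 Y) (p : ℕ → FirstMove 𝕜 Y) (k : ℕ) : SecondMove 𝕜 Y :=
  σ k (fun i => p i)

/-- The second player's last move before turn `k`. -/
def Strategy.before (σ : Strategy 𝕜 Y) (p : ℕ → FirstMove 𝕜 Y) : ℕ → SecondMove 𝕜 Y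
  | 0 => SecondMove.start 𝕜 Y
  | k + 1 => σ.answer p k

/-- The second player has won a completed game: `M` is the set of all indices picked by the second
player and `B` the set of all vectors picked by the first player. The isomorphic embedding of `X`
into `Y` is given as an isomorphism `T` onto a subspace `E` of `Y`. -/
def Won (D C : ℝ) (x : ℕ → X) {E : Submodule 𝕜 Y} (T : X ≃L[𝕜] E) (ε₀ : ℝ)
    (M : Set ℕ) (B : Set Y) : Prop :=
  let S : Set Y := (fun m => (T (x m) : Y)) '' M
  let W : Submodule 𝕜 Y := (Submodule.span 𝕜 S).topologicalClosure
  let Z : Submodule 𝕜 Y := (Submodule.span 𝕜 (B ∪ S)).topologicalClosure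
  (∃ φ : ℕ → ℕ, StrictMono φ ∧ Set.range φ = M ∧ CEquivalent 𝕜 C x (fun n => x (φ n))) ∧
  ∃ P : Z →L[𝕜] Y,
    (∀ z, P z ∈ W) ∧ (∀ z : Z, (z : Y) ∈ W → P z = z) ∧
    ‖P‖ ≤ ‖(T : X →L[𝕜] E)‖ * ‖(T.symm : E →L[𝕜] X)‖ * D ∧
    ∀ z : Z, (z : Y) ∈ (Submodule.span 𝕜 B).topologicalClosure → ‖P z‖ ≤ ε₀ * ‖z‖

/-- The strategy `σ` wins: as long as the first player obeys the rules, so does the second player,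
and if the first player obeys the rules in all turns, then the second player wins. -/
def Strategy.IsWinning (σ : Strategy 𝕜 Y) (D C : ℝ) (x : ℕ → X) (y : SchauderBasis 𝕜 Y)
    {E : Submodule 𝕜 Y} (T : X ≃L[𝕜] E) (ε : ℕ → ℝ) : Prop :=
  ∀ p : ℕ → FirstMove 𝕜 Y,
    (∀ k, (∀ j ≤ k, FirstLegal y (σ.before p j) (p j)) →
      SecondLegal y (fun m => (T (x m) : Y)) (ε (k + 1)) (σ.before p k) (p k) (σ.answer p k)) ∧
    ((∀ k, FirstLegal y (σ.before p k) (p k)) →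
      Won D C x T (ε 0) (⋃ k, ((σ.answer p k).M : Set ℕ)) (⋃ k, ((p k).b : Set Y)))

end ReproducibleGame

open ReproducibleGame in
/-- `x` is a (Schauder) basis of `X` that is two-player `D`-complementably subsequentially
`C`-reproducible. -/
def IsTwoPlayerComplementablyReproducible (𝕜 : Type u) [RCLike 𝕜] {X : Type w}
    [NormedAddCommGroup X] [NormedSpace 𝕜 X] (D C : ℝ) (x : ℕ → X) : Prop :=
  (∃ b : SchauderBasis 𝕜 X, b.basis = x) ∧
  ∀ (Y : Type v) [NormedAddCommGroup Y] [NormedSpace 𝕜 Y] [CompleteSpace Y]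
    (y : SchauderBasis 𝕜 Y) (E : Submodule 𝕜 Y) (T : X ≃L[𝕜] E) (ε : ℕ → ℝ),
    (∀ k, 0 < ε k) → ∃ σ : Strategy 𝕜 Y, σ.IsWinning D C x y T ε

end

/-! A standard basis is a tree. Each of its functions is the indicator of an interval, represented
by the largest point of that interval; two such intervals are nested or disjoint, so they are the
descendant sets of the nodes of a tree with root `ω ^ α`, enumerated with parents first. The value
of a function at a node is the sum of its coefficients along the branch from the root to that node,
and these values determine the norm. Hence a self-embedding `φ` of the tree that keeps parents and
order selects a subsequence isometrically equivalent to the basis, which gives `C = 1`.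

The evaluations at the nodes, transported to `T X`, extend to functionals `g n` on `Y` of norm at
most `‖T⁻¹‖` such that `g n` is a weak-star limit of `g c` along children `c` of `n` whose ranks
approach that of `n` (`IsTreeBasis.exists_extensions`).

The second player builds `φ` one node per turn. In turn `k` the node `k + 1` is sent to a child `c`
of the image `q` of its parent, with rank at least that of `k + 1`, so that the construction never
gets stuck. The basis vectors at the children of `q` are weakly null, so `T x` can be taken almost
inside the allowed window and almost in the kernels of the prescribed functionals; and `g c` is
close to `g q` on all vectors played so far (`exists_isGoodPick`). The second player then demands
that `g (φ m) - g 0` be small on the vectors still to come, for every node `m` already mapped.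

The projection is `P z = ∑ (g (φ (i + 1)) z - g (φ (parent (i + 1))) z) • T x_{φ (i + 1) - 1}`. Its
branch sums telescope to `g (φ n) z - g 0 z`, so its norm is at most `2 ‖T‖ ‖T⁻¹‖`, which gives `D =
2` (`exists_projection`). On the first player's vectors these differences are small: for nodes
mapped earlier by the demands, for later ones by walking back along the branch in geometrically
small steps (`pickStrategy_isWinning`). -/

/-! ### Ranked trees, ancestors and self-embeddings. -/

/-- A tree on `ℕ` with root `0` whose nodes carry ordinal ranks, in which a node of rank greater
than `β` has infinitely many children of rank at least `β`. -/
structure RankedTree where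
  parent : ℕ → ℕ
  rank : ℕ → Ordinal.{0}
  parent_zero : parent 0 = 0
  parent_lt : ∀ n, 0 < n → parent n < n
  rank_lt : ∀ n, 0 < n → rank n < rank (parent n)
  infinite_children : ∀ n β, β < rank n → {c | 0 < c ∧ parent c = n ∧ β ≤ rank c}.Infinite

namespace RankedTree

variable (Γ : RankedTree)

/-- `m` is an ancestor of `n`, or `m = n`. -/
def Anc (m n : ℕ) : Prop := ∃ k, Γ.parent^[k] n = m

variable {Γ}

theorem Anc.refl (n : ℕ) : Γ.Anc n n := ⟨0, rfl⟩

theorem anc_parent (n : ℕ) : Γ.Anc (Γ.parent n) n := ⟨1, rfl⟩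

theorem Anc.trans {l m n : ℕ} : Γ.Anc l m → Γ.Anc m n → Γ.Anc l n := by
  rintro ⟨i, rfl⟩ ⟨j, rfl⟩
  exact ⟨i + j, Function.iterate_add_apply _ _ _ _⟩

theorem parent_le (n : ℕ) : Γ.parent n ≤ n := by
  rcases Nat.eq_zero_or_pos n with rfl | h
  · exact Γ.parent_zero.le
  · exact (Γ.parent_lt n h).le

theorem Anc.le {m n : ℕ} : Γ.Anc m n → m ≤ n := by
  rintro ⟨k, rfl⟩
  induction k with
  | zero => rfl
  | succ k ih =>
    rw [Function.iterate_succ_apply']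
    exact (parent_le _).trans ih

theorem Anc.antisymm {m n : ℕ} (h : Γ.Anc m n) (h' : Γ.Anc n m) : m = n :=
  h.le.antisymm h'.le

theorem anc_zero_right {m : ℕ} : Γ.Anc m 0 ↔ m = 0 :=
  ⟨fun h => Nat.le_zero.1 h.le, fun h => h ▸ Anc.refl _⟩

theorem anc_iff {m n : ℕ} : Γ.Anc m n ↔ m = n ∨ Γ.Anc m (Γ.parent n) := by
  constructor
  · rintro ⟨k, rfl⟩
    cases k with
    | zero => exact Or.inl rfl
    | succ k => exact Or.inr ⟨k, rfl⟩
  · rintro (rfl | h)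
    · exact Anc.refl _
    · exact h.trans (anc_parent n)

theorem not_anc_parent {n : ℕ} (hn : 0 < n) : ¬ Γ.Anc n (Γ.parent n) :=
  fun h => (Γ.parent_lt n hn).not_ge h.le

theorem anc_zero_left (n : ℕ) : Γ.Anc 0 n := by
  induction n using Nat.strong_induction_on with
  | _ n ih =>
    rcases Nat.eq_zero_or_pos n with rfl | h
    · exact Anc.refl _
    · exact (ih _ (Γ.parent_lt n h)).trans (anc_parent n)

theorem Anc.total {l m n : ℕ} : Γ.Anc l n → Γ.Anc m n → Γ.Anc l m ∨ Γ.Anc m l := by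
  rintro ⟨i, rfl⟩ ⟨j, rfl⟩
  rcases le_total i j with h | h
  · obtain ⟨d, rfl⟩ := Nat.exists_eq_add_of_le' h
    exact Or.inr ⟨d, (Function.iterate_add_apply _ _ _ _).symm⟩
  · obtain ⟨d, rfl⟩ := Nat.exists_eq_add_of_le' h
    exact Or.inl ⟨d, (Function.iterate_add_apply _ _ _ _).symm⟩

open Classical in
/-- Telescoping along a branch that is cut at `N`. -/
theorem exists_sum_anc_eq {A : Type*} [AddCommGroup A] (Γ : RankedTree) (H : ℕ → A) (N n : ℕ) :
    ∃ n', ∑ i ∈ Finset.range N,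
      (if Γ.Anc (i + 1) n then H (i + 1) - H (Γ.parent (i + 1)) else 0) = H n' - H 0 := by
  have below : ∀ n, n ≤ N → ∑ i ∈ Finset.range N,
      (if Γ.Anc (i + 1) n then H (i + 1) - H (Γ.parent (i + 1)) else 0) = H n - H 0 := by
    intro n
    induction n using Nat.strong_induction_on with
    | _ n ih =>
      intro hn
      rcases n with _ | n
      · simp [anc_zero_right]
      · have hp := Γ.parent_lt (n + 1) n.succ_pos
        have key : ∀ i, (if Γ.Anc (i + 1) (n + 1) then H (i + 1) - H (Γ.parent (i + 1)) else 0) =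
            (if i = n then H (n + 1) - H (Γ.parent (n + 1)) else 0) +
            (if Γ.Anc (i + 1) (Γ.parent (n + 1)) then H (i + 1) - H (Γ.parent (i + 1)) else 0) := by
          intro i
          by_cases hi : i = n
          · subst hi
            rw [if_pos (Anc.refl _), if_pos rfl, if_neg (not_anc_parent i.succ_pos), add_zero]
          · rw [if_neg hi, zero_add, anc_iff, or_iff_right (by omega)]
        rw [Finset.sum_congr rfl fun i _ => key i, Finset.sum_add_distrib,
          ih _ hp (hp.le.trans hn), Finset.sum_ite_eq', if_pos (Finset.mem_range.2 hn)]
        abel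
  -- A node beyond `N` contributes no term of its own, so it can be replaced by its parent until it
  -- is at most `N`.
  induction n using Nat.strong_induction_on with
  | _ n ih =>
    rcases le_or_gt n N with h | h
    · exact ⟨n, below n h⟩
    · obtain ⟨n', hn'⟩ := ih _ (Γ.parent_lt n (by omega))
      refine ⟨n', hn' ▸ Finset.sum_congr rfl fun i hi => ?_⟩
      rw [anc_iff, or_iff_right]
      have := Finset.mem_range.1 hi
      omega

/-- An embedding of the tree into itself that respects parents. -/
structure IsEmbedding (Γ : RankedTree) (φ : ℕ → ℕ) : Prop where
  map_zero : φ 0 = 0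
  strictMono : StrictMono φ
  parent_map : ∀ n, 0 < n → Γ.parent (φ n) = φ (Γ.parent n)

theorem IsEmbedding.id : Γ.IsEmbedding id := ⟨rfl, strictMono_id, fun _ _ => rfl⟩

namespace IsEmbedding

variable {φ : ℕ → ℕ}

theorem iterate_parent (hφ : Γ.IsEmbedding φ) (k n : ℕ) :
    Γ.parent^[k] (φ n) = φ (Γ.parent^[k] n) := by
  induction k with
  | zero => rfl
  | succ k ih =>
    rw [Function.iterate_succ_apply', ih, Function.iterate_succ_apply']
    rcases Nat.eq_zero_or_pos (Γ.parent^[k] n) with h | h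
    · rw [h, hφ.map_zero, Γ.parent_zero, hφ.map_zero]
    · exact hφ.parent_map _ h

theorem anc_map_iff (hφ : Γ.IsEmbedding φ) {m n : ℕ} : Γ.Anc (φ m) (φ n) ↔ Γ.Anc m n := by
  simp only [Anc, hφ.iterate_parent, hφ.strictMono.injective.eq_iff]

/-- Seen from the range of an embedding, every node looks like a node in that range. -/
theorem exists_anc_map_iff (hφ : Γ.IsEmbedding φ) (m : ℕ) :
    ∃ n, ∀ i, Γ.Anc (φ i) m ↔ Γ.Anc i n := by
  classical
  have h0 : Γ.Anc (φ 0) m := hφ.map_zero.symm ▸ anc_zero_left m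
  have bound : ∀ i, Γ.Anc (φ i) m → i ≤ m := fun i hi => (hφ.strictMono.id_le i).trans hi.le
  -- The nodes `φ i` on the branch of `m` form a chain, so the last of them determines all the
  -- others.
  have hn := Nat.findGreatest_spec (P := fun i => Γ.Anc (φ i) m) (Nat.zero_le m) h0
  refine ⟨Nat.findGreatest (fun i => Γ.Anc (φ i) m) m, fun i => ⟨fun hi => ?_, fun hi => ?_⟩⟩
  · have hle := Nat.le_findGreatest (P := fun i => Γ.Anc (φ i) m) (bound i hi) hi
    rcases hi.total hn with h | h
    · exact hφ.anc_map_iff.1 h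
    · have := (hφ.anc_map_iff.1 h).le.antisymm hle
      rw [this]
      exact Anc.refl _
  · exact (hφ.anc_map_iff.2 hi).trans hn

theorem pos (hφ : Γ.IsEmbedding φ) (n : ℕ) : 0 < φ (n + 1) :=
  (Nat.zero_le _).trans_lt (hφ.strictMono n.lt_succ_self)

end IsEmbedding

end RankedTree

/-! ### Grafting countably many trees onto a new root. -/

namespace RankedTree

/-- The tree with a new root of rank `γ` whose children are the roots of the trees `Γ k`; the node
`j + 1` is the node `(e j).2` of the tree `Γ (e j).1`. -/
noncomputable def graft (Γ : ℕ → RankedTree) (e : ℕ ≃ ℕ × ℕ) (he : IsAdmissibleOrder e)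
    (γ : Ordinal.{0}) (hlt : ∀ k, (Γ k).rank 0 < γ)
    (hinf : ∀ β < γ, {k | β ≤ (Γ k).rank 0}.Infinite) : RankedTree where
  parent
    | 0 => 0
    | j + 1 => if (e j).2 = 0 then 0 else e.symm ((e j).1, (Γ (e j).1).parent (e j).2) + 1
  rank
    | 0 => γ
    | j + 1 => (Γ (e j).1).rank (e j).2
  parent_zero := rfl
  parent_lt := by
    rintro (_ | j) hj
    · exact absurd hj (lt_irrefl 0)
    · dsimp only
      split_ifs with h
      · exact j.succ_pos
      · exact Nat.succ_lt_succ (he _ _ (e j).1 ((Γ (e j).1).parent (e j).2) (e j).2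
          (e.apply_symm_apply _) rfl ((Γ _).parent_lt _ (Nat.pos_of_ne_zero h)))
  rank_lt := by
    rintro (_ | j) hj
    · exact absurd hj (lt_irrefl 0)
    · dsimp only
      by_cases h : (e j).2 = 0
      · rw [if_pos h, h]
        exact hlt _
      · rw [if_neg h]
        simpa using (Γ (e j).1).rank_lt _ (Nat.pos_of_ne_zero h)
  infinite_children := by
    rintro (_ | j) β hβ
    · refine ((hinf β hβ).image (f := fun k => e.symm (k, 0) + 1) ?_).mono ?_
      · intro k _ l _ h
        simpa using h
      · rintro _ ⟨k, hk, rfl⟩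
        exact ⟨Nat.succ_pos _, by simp, by simpa using hk⟩
    · refine (((Γ (e j).1).infinite_children (e j).2 β hβ).image
        (f := fun n => e.symm ((e j).1, n) + 1) ?_).mono ?_
      · intro k _ l _ h
        simpa using h
      · rintro _ ⟨n, ⟨hn, hp, hr⟩, rfl⟩
        exact ⟨Nat.succ_pos _, by simp [hn.ne', hp], by simpa using hr⟩

variable {Γ : ℕ → RankedTree} {e : ℕ ≃ ℕ × ℕ} {he : IsAdmissibleOrder e} {γ : Ordinal.{0}}
  {hlt : ∀ k, (Γ k).rank 0 < γ} {hinf : ∀ β < γ, {k | β ≤ (Γ k).rank 0}.Infinite}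

theorem graft_parent_succ (k n : ℕ) :
    (graft Γ e he γ hlt hinf).parent (e.symm (k, n) + 1) =
      if n = 0 then 0 else e.symm (k, (Γ k).parent n) + 1 := by
  simp [graft]

/-- A branch stays inside its own piece until it jumps from the root of that piece to the new root.
-/
theorem anc_graft_iff (k n k' n' : ℕ) :
    (graft Γ e he γ hlt hinf).Anc (e.symm (k, n) + 1) (e.symm (k', n') + 1) ↔
      k = k' ∧ (Γ k').Anc n n' := by
  induction n' using Nat.strong_induction_on with
  | _ n' ih =>
    rw [anc_iff, graft_parent_succ]
    rcases Nat.eq_zero_or_pos n' with rfl | h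
    · simp [anc_zero_right]
    · rw [if_neg h.ne', ih _ ((Γ k').parent_lt _ h), anc_iff (n := n')]
      simp only [add_left_inj, EmbeddingLike.apply_eq_iff_eq, Prod.mk.injEq]
      tauto

end RankedTree

/-! ### Standard families as indicators of descendant sets. -/

section StandardFamily

open Ordinal

open Classical in
/-- The functions `f m` are, on `(0, ω ^ α]`, the indicators of the sets of the descendants of the
nodes of a tree, whose nodes enumerate `(0, ω ^ α]` by `t`. -/
structure IsTreeFamily {𝕜 : Type u} [RCLike 𝕜] (Γ : RankedTree) (t : ℕ → Ordinal.{0})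
    (α : Ordinal.{0}) (f : ℕ → Ordinal.{0} → 𝕜) : Prop where
  rank_zero : Γ.rank 0 = α
  top_zero : t 0 = ω ^ α
  range_eq : Set.range t = Set.Ioc 0 (ω ^ α)
  apply_eq : ∀ m k, f m (t k) = if Γ.Anc m k then 1 else 0

theorem IsTreeFamily.mem {𝕜 : Type u} [RCLike 𝕜] {Γ : RankedTree} {t : ℕ → Ordinal.{0}}
    {α : Ordinal.{0}} {f : ℕ → Ordinal.{0} → 𝕜} (h : IsTreeFamily Γ t α f) (n : ℕ) :
    t n ∈ Set.Ioc 0 (ω ^ α) :=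
  h.range_eq ▸ Set.mem_range_self n

variable {𝕜 : Type u} [RCLike 𝕜]

/-- The pieces `(a k, a (k + 1)]` partition `(0, ω ^ γ)`, and grafting mirrors this: the point `ω ^
γ` becomes the new root, and the tree of each piece is moved by `a k`. The shift is undone by
ordinal subtraction. -/
theorem exists_isTreeFamily_assemble {Γ : ℕ → RankedTree} {t : ℕ → ℕ → Ordinal.{0}}
    {αs : ℕ → Ordinal.{0}} {f : ℕ → ℕ → Ordinal.{0} → 𝕜}
    (h : ∀ k, IsTreeFamily (Γ k) (t k) (αs k) (f k)) {e : ℕ ≃ ℕ × ℕ} (he : IsAdmissibleOrder e)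
    {γ : Ordinal.{0}} (hlt : ∀ k, αs k < γ) (hinf : ∀ β < γ, {k | β ≤ αs k}.Infinite)
    {a : ℕ → Ordinal.{0}} (a_zero : a 0 = 0) (ha : ∀ k, a k + ω ^ αs k = a (k + 1))
    (ha_lt : ∀ k, a k < ω ^ γ) (ha_cof : ∀ ρ < ω ^ γ, ∃ k, ρ ≤ a (k + 1)) :
    ∃ (Γ : RankedTree) (t : ℕ → Ordinal.{0}),
      IsTreeFamily Γ t γ (assemble 𝕜 (ω ^ γ) a f e) := by
  classical
  have ha_mono : Monotone a := monotone_nat_of_le_succ fun k => ha k ▸ le_self_add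
  have mem_piece : ∀ k n, a k + t k n ∈ Set.Ioc (a k) (a (k + 1)) := fun k n =>
    ⟨by simpa using ((h k).mem n).1, ha k ▸ add_le_add_right ((h k).mem n).2 _⟩
  have piece_unique : ∀ {k l ρ}, ρ ∈ Set.Ioc (a k) (a (k + 1)) →
      ρ ∈ Set.Ioc (a l) (a (l + 1)) → k = l := by
    intro k l ρ hk hl
    by_contra hne
    rcases Nat.lt_or_gt_of_ne hne with hkl | hkl
    · exact (hl.1.trans_le (hk.2.trans (ha_mono hkl))).false
    · exact (hk.1.trans_le (hl.2.trans (ha_mono hkl))).false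
  let t' : ℕ → Ordinal.{0} := fun
    | 0 => ω ^ γ
    | j + 1 => a (e j).1 + t (e j).1 (e j).2
  have ht' : ∀ k n, t' (e.symm (k, n) + 1) = a k + t k n := fun k n => by simp [t']
  refine ⟨RankedTree.graft Γ e he γ (fun k => (h k).rank_zero ▸ hlt k)
    (fun β hβ => by simpa only [(h _).rank_zero] using hinf β hβ), t', rfl, rfl, ?_, ?_⟩
  · ext ρ
    constructor
    · rintro ⟨_ | j, rfl⟩
      · exact ⟨opow_pos _ omega0_pos, le_rfl⟩
      · exact ⟨(zero_le).trans_lt (mem_piece _ _).1, (mem_piece _ _).2.trans (ha_lt _).le⟩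
    · rintro ⟨h0, hρ⟩
      rcases hρ.eq_or_lt with rfl | hρ
      · exact ⟨0, rfl⟩
      · have hex := ha_cof ρ hρ
        have hle := Nat.find_spec hex
        -- The piece that contains `ρ` is the first one whose right end reaches `ρ`.
        set k := Nat.find hex with hk
        have hgt : a k < ρ := by
          rcases hk' : k with _ | l
          · rwa [a_zero]
          · exact not_le.1 (Nat.find_min hex (m := l) (by omega))
        have hsub : ρ - a k ∈ Set.range (t k) := by
          rw [(h k).range_eq]
          refine ⟨?_, Ordinal.sub_le.2 ((ha k).symm ▸ hle)⟩
          rw [Ordinal.lt_sub]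
          simpa using hgt
        obtain ⟨n, hn⟩ := hsub
        exact ⟨e.symm (k, n) + 1, by rw [ht', hn, Ordinal.add_sub_cancel_of_le hgt.le]⟩
  · rintro (_ | i) j
    · rw [if_pos (RankedTree.anc_zero_left j)]
      refine Set.indicator_of_mem ?_ _
      rcases j with _ | j
      · exact ⟨opow_pos _ omega0_pos, le_rfl⟩
      · exact ⟨(zero_le).trans_lt (mem_piece _ _).1, (mem_piece _ _).2.trans (ha_lt _).le⟩
    · obtain ⟨⟨k, n⟩, rfl⟩ := e.symm.surjective i
      simp only [assemble, Equiv.apply_symm_apply]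
      rcases j with _ | j
      · rw [if_neg (by simp [RankedTree.anc_zero_right]), Set.indicator_of_notMem]
        exact fun hm => (hm.2.trans_lt (ha_lt _)).false
      · obtain ⟨⟨k', n'⟩, rfl⟩ := e.symm.surjective j
        simp only [RankedTree.anc_graft_iff, ht']
        by_cases hkk : k = k'
        · subst hkk
          rw [Set.indicator_of_mem (mem_piece _ _), Ordinal.add_sub_cancel, (h k).apply_eq]
          simp
        · rw [if_neg (fun hh => hkk hh.1), Set.indicator_of_notMem]
          exact fun hm => hkk (piece_unique hm (mem_piece k' n'))

/-- The tree of height one. -/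
noncomputable def RankedTree.star : RankedTree where
  parent _ := 0
  rank n := if n = 0 then 1 else 0
  parent_zero := rfl
  parent_lt _ hn := hn
  rank_lt n hn := by simp [hn.ne']
  infinite_children n β hβ := by
    rcases Nat.eq_zero_or_pos n with rfl | hn
    · refine (Set.Ioi_infinite 0).mono fun c hc => ⟨hc, rfl, ?_⟩
      have : β = 0 := by simpa using hβ
      rw [this]
      exact zero_le
    · simp [hn.ne'] at hβ

/-- The three constructors yield the star, a graft of infinitely many copies of one tree, and a
graft of trees whose ranks increase to the limit. In both grafts the new root has infinitely many
children of rank at least any given smaller ordinal. -/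
theorem exists_isTreeFamily {α : Ordinal.{0}} {f : ℕ → Ordinal.{0} → 𝕜}
    (h : IsStandardFamily 𝕜 α f) :
    ∃ (Γ : RankedTree) (t : ℕ → Ordinal.{0}), IsTreeFamily Γ t α f := by
  classical
  induction h with
  | one =>
    refine ⟨RankedTree.star, fun n => if n = 0 then ω else n, by simp [RankedTree.star],
      by simp, ?_, ?_⟩
    · ext ρ
      rw [opow_one]
      constructor
      · rintro ⟨n, rfl⟩
        rcases Nat.eq_zero_or_pos n with rfl | hn
        · simp [omega0_pos]
        · simp [hn.ne', hn, (natCast_lt_omega0 n).le]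
      · rintro ⟨h0, hρ⟩
        rcases hρ.eq_or_lt with rfl | hρ
        · exact ⟨0, by simp⟩
        · obtain ⟨n, rfl⟩ := lt_omega0.1 hρ
          have : n ≠ 0 := by rintro rfl; simp at h0
          exact ⟨n, by simp [this]⟩
    · intro m k
      rcases Nat.eq_zero_or_pos m with rfl | hm
      · rw [if_pos (RankedTree.anc_zero_left k), if_pos rfl]
        refine Set.indicator_of_mem ?_ _
        rcases Nat.eq_zero_or_pos k with rfl | hk
        · simp [omega0_pos]
        · simp [hk.ne', hk, (natCast_lt_omega0 k).le]
      · have : RankedTree.star.Anc m k ↔ m = k := by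
          rw [RankedTree.anc_iff]
          refine or_iff_left fun hh => hm.ne' (RankedTree.anc_zero_right.1 hh)
        simp only [this, if_neg hm.ne']
        rcases Nat.eq_zero_or_pos k with rfl | hk
        · simp [hm.ne', (natCast_lt_omega0 m).ne']
        · simp [hk.ne', Set.indicator_apply, eq_comm]
  | succ γ x e hx he ih =>
    obtain ⟨Γ, t, h⟩ := ih
    refine exists_isTreeFamily_assemble (fun _ : ℕ => h) he (γ := γ + 1)
      (fun _ => lt_add_one γ) ?_ ?_ ?_ ?_ ?_
    · intro β hβ
      have : {k : ℕ | β ≤ γ} = Set.univ := Set.eq_univ_of_forall fun _ => Order.lt_add_one_iff.1 hβ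
      rw [this]
      exact Set.infinite_univ
    · simp
    · intro k
      rw [Nat.cast_succ, mul_add_one]
    · intro k
      rw [opow_add_one]
      exact mul_lt_mul_of_pos_left (natCast_lt_omega0 k) (opow_pos _ omega0_pos)
    · intro ρ hρ
      rw [opow_add_one, lt_mul_iff_of_isSuccLimit isSuccLimit_omega0] at hρ
      obtain ⟨c, hc, hρ⟩ := hρ
      obtain ⟨n, rfl⟩ := lt_omega0.1 hc
      refine ⟨n, hρ.le.trans ?_⟩
      gcongr
      exact n.le_succ
  | limit γ γs x e hmono hlim hx he ih =>
    choose Γ t h using ih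
    have hlt : ∀ k, γs k < γ := fun k =>
      (hmono k.lt_succ_self).trans_le (hlim.1 (Set.mem_range_self _))
    have hex : ∀ β < γ, ∃ k, β < γs k := fun β hβ => by
      obtain ⟨_, ⟨k, rfl⟩, hk, -⟩ := hlim.exists_between hβ
      exact ⟨k, hk⟩
    refine exists_isTreeFamily_assemble h he hlt ?_ rfl ?_ ?_ ?_
    · intro β hβ
      obtain ⟨k, hk⟩ := hex β hβ
      exact (Set.Ici_infinite k).mono fun l hl => hk.le.trans (hmono.monotone hl)
    · rintro (_ | k)
      · simp [limitCuts]
      -- The left end `ω ^ γs k` is absorbed by the larger power, so the next piece has length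
      -- exactly `ω ^ γs (k + 1)`.
      · exact add_of_omega0_opow_le
          ((opow_lt_opow_iff_right one_lt_omega0).2 (hmono k.lt_succ_self)) le_rfl
    · rintro (_ | k)
      · exact opow_pos _ omega0_pos
      · exact (opow_lt_opow_iff_right one_lt_omega0).2 (hlt k)
    · intro ρ hρ
      have hγ : Order.IsSuccLimit γ := by
        refine ⟨fun hm => (zero_le.trans_lt (hlt 0)).ne' (isMin_iff_eq_bot.1 hm), fun β hβ => ?_⟩
        obtain ⟨k, hk⟩ := hex β hβ.lt
        exact hβ.2 hk (hlt k)
      obtain ⟨c, hc, hρ⟩ := (lt_opow_of_isSuccLimit omega0_ne_zero hγ).1 hρ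
      obtain ⟨k, hk⟩ := hex c hc
      exact ⟨k, hρ.le.trans (opow_le_opow_right omega0_pos hk.le)⟩

end StandardFamily

/-! ### Tree bases: norms, subsequences, the Schauder property. -/

open Filter Topology

/-- Pointwise convergence to zero of a bounded family of operators passes to the closed span. -/
theorem tendsto_zero_of_mem_closure_span {𝕜 : Type*} [RCLike 𝕜] {E : Type*} [NormedAddCommGroup E]
    [NormedSpace 𝕜 E] {F : Type*} [NormedAddCommGroup F] [NormedSpace 𝕜 F] {ι : Type*}
    {l : Filter ι} {L : ι → E →L[𝕜] F} {C : ℝ} (hC : ∀ i z, ‖L i z‖ ≤ C * ‖z‖) {S : Set E}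
    (hS : ∀ z ∈ S, Tendsto (fun i => L i z) l (𝓝 0)) {z : E}
    (hz : z ∈ (Submodule.span 𝕜 S).topologicalClosure) : Tendsto (fun i => L i z) l (𝓝 0) := by
  have hspan : ∀ z ∈ Submodule.span 𝕜 S, Tendsto (fun i => L i z) l (𝓝 0) := by
    intro z hz
    induction hz using Submodule.span_induction with
    | mem z hz => exact hS z hz
    | zero => simpa using tendsto_const_nhds
    | add x y _ _ hx hy => simpa using hx.add hy
    | smul c x _ hx => simpa using hx.const_smul c
  rw [Metric.tendsto_nhds]
  intro ε hε
  -- Nothing is assumed on the sign of `C`, so a positive upper bound replaces it as divisor.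
  have hC' : 0 < |C| + 1 := by positivity
  obtain ⟨s, hs, hzs⟩ := Metric.mem_closure_iff.1 hz (ε / 2 / (|C| + 1)) (by positivity)
  filter_upwards [Metric.tendsto_nhds.1 (hspan s hs) (ε / 2) (by positivity)] with i hi
  rw [dist_zero_right] at hi ⊢
  rw [dist_eq_norm, lt_div_iff₀ hC'] at hzs
  have h1 : ‖L i (z - s)‖ < ε / 2 := by
    refine (hC i _).trans_lt (lt_of_le_of_lt ?_ hzs)
    rw [mul_comm]
    gcongr
    exact (le_abs_self C).trans (le_add_of_nonneg_right zero_le_one)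
  calc ‖L i z‖ = ‖L i (z - s) + L i s‖ := by simp
    _ ≤ ‖L i (z - s)‖ + ‖L i s‖ := norm_add_le _ _
    _ < ε := by linarith

open Classical in
/-- The vector `x i` belongs to the node `i + 1` of the tree. The functionals `δ n` add up the
coefficients along the branches; they are norming, and the span of the `x i` is dense. -/
structure IsTreeBasis {𝕜 : Type u} [RCLike 𝕜] {X : Type w} [NormedAddCommGroup X] [NormedSpace 𝕜 X]
    (Γ : RankedTree) (x : ℕ → X) (δ : ℕ → StrongDual 𝕜 X) : Prop where
  apply_eq : ∀ n i, δ n (x i) = if Γ.Anc (i + 1) n then 1 else 0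
  norm_apply_le : ∀ n f, ‖δ n f‖ ≤ ‖f‖
  norm_le : ∀ f C, (∀ n, ‖δ n f‖ ≤ C) → ‖f‖ ≤ C
  dense : (Submodule.span 𝕜 (Set.range x)).topologicalClosure = ⊤

namespace IsTreeBasis

variable {𝕜 : Type u} [RCLike 𝕜] {X : Type w} [NormedAddCommGroup X] [NormedSpace 𝕜 X]
  {Γ : RankedTree} {x : ℕ → X} {δ : ℕ → StrongDual 𝕜 X}

/-- No basis vector belongs to the root, so `δ 0` vanishes on a dense subspace. This is why branch
sums start from zero. -/
theorem apply_zero (h : IsTreeBasis Γ x δ) (f : X) : δ 0 f = 0 := by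
  have hf : f ∈ (Submodule.span 𝕜 (Set.range x)).topologicalClosure := h.dense ▸ Submodule.mem_top
  have := tendsto_zero_of_mem_closure_span (l := (⊤ : Filter Unit)) (L := fun _ => δ 0) (C := 1)
    (fun _ z => by simpa using h.norm_apply_le 0 z) ?_ hf
  · simpa using this
  · rintro _ ⟨i, rfl⟩
    simp [h.apply_eq, RankedTree.anc_zero_right]

theorem norm_basis (h : IsTreeBasis Γ x δ) (i : ℕ) : ‖x i‖ = 1 := by
  refine le_antisymm (h.norm_le _ _ fun n => ?_) ?_
  · rw [h.apply_eq]
    split_ifs <;> simp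
  · simpa [h.apply_eq, RankedTree.Anc.refl] using h.norm_apply_le (i + 1) (x i)

/-- The combination of the `x i` whose sums along the branches are `H n - H 0`, cut at `N`. -/
theorem norm_sum_sub_parent_le (h : IsTreeBasis Γ x δ) {φ : ℕ → ℕ} (hφ : Γ.IsEmbedding φ)
    (H : ℕ → 𝕜) {C : ℝ} (hC : ∀ n, ‖H n - H 0‖ ≤ C) (N : ℕ) :
    ‖∑ i ∈ Finset.range N, (H (i + 1) - H (Γ.parent (i + 1))) • x (φ (i + 1) - 1)‖ ≤ C := by
  classical
  refine h.norm_le _ _ fun m => ?_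
  -- Among the selected nodes the branch of `m` looks like the branch of `n`, and the cut at `N`
  -- leaves the branch of `n'`.
  obtain ⟨n, hn⟩ := hφ.exists_anc_map_iff m
  obtain ⟨n', hn'⟩ := Γ.exists_sum_anc_eq H N n
  have : δ m (∑ i ∈ Finset.range N, (H (i + 1) - H (Γ.parent (i + 1))) • x (φ (i + 1) - 1)) =
      H n' - H 0 := by
    rw [← hn', map_sum]
    refine Finset.sum_congr rfl fun i _ => ?_
    rw [map_smul, h.apply_eq, Nat.sub_add_cancel (hφ.pos i)]
    simp [hn]
  rw [this]
  exact hC n'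

/-- Both sums take the same values at nodes: every `m` acts on the selected vectors as some `n` acts
on the full basis, and every `n` is matched by `φ n`. The evaluations are norming, so the
subsequence is isometrically equivalent to the basis. -/
theorem norm_sum_comp (h : IsTreeBasis Γ x δ) {φ : ℕ → ℕ} (hφ : Γ.IsEmbedding φ)
    (s : Finset ℕ) (a : ℕ → 𝕜) :
    ‖∑ i ∈ s, a i • x (φ (i + 1) - 1)‖ = ‖∑ i ∈ s, a i • x i‖ := by
  classical
  have key : ∀ m n, (∀ i, Γ.Anc (φ i) m ↔ Γ.Anc i n) →
      δ m (∑ i ∈ s, a i • x (φ (i + 1) - 1)) = δ n (∑ i ∈ s, a i • x i) := by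
    intro m n hmn
    simp only [map_sum, map_smul, h.apply_eq, Nat.sub_add_cancel (hφ.pos _), hmn]
  refine le_antisymm (h.norm_le _ _ fun m => ?_) (h.norm_le _ _ fun n => ?_)
  · obtain ⟨n, hn⟩ := hφ.exists_anc_map_iff m
    rw [key m n hn]
    exact h.norm_apply_le _ _
  · rw [← key (φ n) n fun i => hφ.anc_map_iff]
    exact h.norm_apply_le _ _

/-- The coordinates of a tree basis. -/
theorem apply_sub_apply_parent (h : IsTreeBasis Γ x δ) {φ : ℕ → ℕ} (hφ : Γ.IsEmbedding φ)
    (i j : ℕ) :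
    δ (φ (i + 1)) (x (φ (j + 1) - 1)) - δ (φ (Γ.parent (i + 1))) (x (φ (j + 1) - 1)) =
      if i = j then 1 else 0 := by
  classical
  rw [h.apply_eq, h.apply_eq, Nat.sub_add_cancel (hφ.pos j), hφ.anc_map_iff, hφ.anc_map_iff,
    RankedTree.anc_iff (n := i + 1)]
  by_cases hij : i = j
  · subst hij
    simp [RankedTree.not_anc_parent]
  · simp [hij, Ne.symm hij]

/-- A tree basis is a Schauder basis. -/
theorem exists_schauderBasis (h : IsTreeBasis Γ x δ) : ∃ b : SchauderBasis 𝕜 X, b.basis = x := by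
  classical
  -- The coefficient at a node is the increment of the branch sum from its parent to the node.
  refine ⟨⟨x, fun i => δ (i + 1) - δ (Γ.parent (i + 1)), fun i j => ?_, fun f => ?_⟩, rfl⟩
  · have := h.apply_sub_apply_parent RankedTree.IsEmbedding.id i j
    simp only [id, Nat.add_sub_cancel] at this
    refine Eq.trans this ?_
    by_cases hij : i = j <;> simp [hij]
  -- The error of the partial sum operator has norm at most `2` and is eventually zero on each basis
  -- vector.
  · let L : ℕ → X →L[𝕜] X := fun N =>
      ∑ i ∈ Finset.range N, (δ (i + 1) - δ (Γ.parent (i + 1))).smulRight (x i) -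
        ContinuousLinearMap.id 𝕜 X
    have hL : ∀ N f, L N f = ∑ i ∈ Finset.range N,
        (δ (i + 1) f - δ (Γ.parent (i + 1)) f) • x i - f := by
      intro N f
      simp [L]
    have hlim := tendsto_zero_of_mem_closure_span (l := atTop) (L := L) (C := 2)
      (S := Set.range x) (z := f) ?_ ?_ (h.dense ▸ Submodule.mem_top)
    · rw [HasSum, SummationFilter.conditional_filter_eq_map_range, tendsto_map'_iff]
      have := hlim.add_const f
      simpa [hL, Function.comp_def] using this
    · intro N z
      rw [hL]
      refine (norm_sub_le _ _).trans ?_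
      have := h.norm_sum_sub_parent_le RankedTree.IsEmbedding.id (fun n => δ n z) (C := ‖z‖)
        (fun n => by simpa [h.apply_zero] using h.norm_apply_le n z) N
      simp only [id, Nat.add_sub_cancel] at this
      linarith
    · rintro _ ⟨j, rfl⟩
      refine tendsto_const_nhds.congr' ?_
      filter_upwards [eventually_gt_atTop j] with N hN
      have := h.apply_sub_apply_parent RankedTree.IsEmbedding.id (j := j)
      simp only [id, Nat.add_sub_cancel] at this
      simp [hL, this, hN]

end IsTreeBasis

/-! ### Density of the span, by Stone–Weierstrass. -/

section

open Ordinal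

variable {𝕜 : Type u} [RCLike 𝕜]

/-- A continuous function that vanishes at `ω ^ α` is a limit of combinations of the functions of
a tree family without the first one. -/
theorem IsTreeFamily.exists_mem_span_norm_sub_lt {α : Ordinal.{0}} {Γ : RankedTree}
    {t : ℕ → Ordinal.{0}} {f : ℕ → Ordinal.{0} → 𝕜} (h : IsTreeFamily Γ t α f) {x : ℕ → C0 𝕜 α}
    (hx : ∀ (n : ℕ) (ρ : OrdInterval α), (x n : C(OrdInterval α, 𝕜)) ρ = f (n + 1) ρ)
    (g : C0 𝕜 α) {ε : ℝ} (hε : 0 < ε) :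
    ∃ s ∈ Submodule.span 𝕜 (Set.range x), ‖g - s‖ < ε := by
  classical
  have hsurj : ∀ ρ : OrdInterval α, ∃ n, t n = ρ := fun ρ => by
    have : (ρ : Ordinal.{0}) ∈ Set.range t := by
      rw [h.range_eq]
      exact ⟨zero_lt_one.trans_le ρ.2.1, ρ.2.2⟩
    exact this
  have hx' : ∀ i n (ρ : OrdInterval α), t n = ρ →
      (x i : C(OrdInterval α, 𝕜)) ρ = if Γ.Anc (i + 1) n then 1 else 0 := fun i n ρ hρ => by
    rw [hx, ← hρ, h.apply_eq]
  let X : ℕ → C(OrdInterval α, 𝕜) := fun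
    | 0 => 1
    | i + 1 => x i
  have hX : ∀ m n (ρ : OrdInterval α), t n = ρ → X m ρ = if Γ.Anc m n then 1 else 0 := by
    rintro (_ | m) n ρ hρ
    · rw [if_pos (RankedTree.anc_zero_left n)]
      rfl
    · exact hx' m n ρ hρ
  -- Two descendant sets are nested or disjoint, so a product is one of its factors or zero; this
  -- makes the span of the `X m` an algebra.
  have hmul : ∀ m n, X m * X n ∈ Submodule.span 𝕜 (Set.range X) := by
    intro m n
    have hcase : X m * X n = X n ∨ X m * X n = X m ∨ X m * X n = 0 := by
      by_cases hmn : Γ.Anc m n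
      · refine Or.inl (ContinuousMap.ext fun ρ => ?_)
        obtain ⟨k, hk⟩ := hsurj ρ
        rw [ContinuousMap.mul_apply, hX m k ρ hk, hX n k ρ hk]
        by_cases hn : Γ.Anc n k
        · simp [hn, hmn.trans hn]
        · simp [hn]
      by_cases hnm : Γ.Anc n m
      · refine Or.inr (Or.inl (ContinuousMap.ext fun ρ => ?_))
        obtain ⟨k, hk⟩ := hsurj ρ
        rw [ContinuousMap.mul_apply, hX m k ρ hk, hX n k ρ hk]
        by_cases hm : Γ.Anc m k
        · simp [hm, hnm.trans hm]
        · simp [hm]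
      · refine Or.inr (Or.inr (ContinuousMap.ext fun ρ => ?_))
        obtain ⟨k, hk⟩ := hsurj ρ
        rw [ContinuousMap.mul_apply, hX m k ρ hk, hX n k ρ hk]
        by_cases hm : Γ.Anc m k
        · have hn : ¬ Γ.Anc n k := fun hn => (hm.total hn).elim hmn hnm
          simp [hn]
        · simp [hm]
    rcases hcase with h | h | h <;> rw [h]
    · exact Submodule.subset_span ⟨n, rfl⟩
    · exact Submodule.subset_span ⟨m, rfl⟩
    · exact Submodule.zero_mem _
  let A : StarSubalgebra 𝕜 C(OrdInterval α, 𝕜) :=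
    { Submodule.span 𝕜 (Set.range X) with
      mul_mem' := by
        intro a b ha hb
        have := Submodule.mul_mem_mul ha hb
        rw [Submodule.span_mul_span] at this
        refine Submodule.span_le.2 ?_ this
        rintro _ ⟨_, ⟨m, rfl⟩, _, ⟨n, rfl⟩, rfl⟩
        exact hmul m n
      one_mem' := Submodule.subset_span ⟨0, rfl⟩
      algebraMap_mem' := by
        intro r
        rw [Algebra.algebraMap_eq_smul_one]
        exact Submodule.smul_mem _ r (Submodule.subset_span ⟨0, rfl⟩)
      star_mem' := by
        intro a ha
        induction ha using Submodule.span_induction with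
        | mem a ha =>
          obtain ⟨m, rfl⟩ := ha
          have : star (X m) = X m := by
            ext ρ
            obtain ⟨k, hk⟩ := hsurj ρ
            rw [ContinuousMap.star_apply, hX m k ρ hk]
            split_ifs <;> simp
          rw [this]
          exact Submodule.subset_span ⟨m, rfl⟩
        | zero => simp
        | add a b _ _ ha hb =>
          rw [star_add]
          exact Submodule.add_mem _ ha hb
        | smul c a _ ha =>
          rw [star_smul]
          exact Submodule.smul_mem _ _ ha }
  have hsep : A.SeparatesPoints := by
    intro ρ σ hne
    obtain ⟨m, hm⟩ := hsurj ρ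
    obtain ⟨n, hn⟩ := hsurj σ
    by_contra! hall
    have hA : ∀ i, X i ρ = X i σ := fun i =>
      hall _ ⟨X i, Submodule.subset_span ⟨i, rfl⟩, rfl⟩
    have h1 := hA m
    have h2 := hA n
    rw [hX _ m ρ hm, hX _ n σ hn] at h1 h2
    simp only [RankedTree.Anc.refl, if_true] at h1 h2
    have h1' : Γ.Anc m n := by by_contra hc; simp [hc] at h1
    have h2' : Γ.Anc n m := by by_contra hc; simp [hc] at h2
    have := h1'.antisymm h2'
    subst this
    exact hne (Subtype.ext (hm.symm.trans hn))
  have hdense := ContinuousMap.starSubalgebra_topologicalClosure_eq_top_of_separatesPoints A hsep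
  have htop : (1 : Ordinal.{0}) ≤ ω ^ α := Order.one_le_iff_pos.2 (opow_pos _ omega0_pos)
  let τ : OrdInterval α := ⟨ω ^ α, htop, le_rfl⟩
  have hvanish : ∀ g : C0 𝕜 α, (g : C(OrdInterval α, 𝕜)) τ = 0 := fun g => g.2 τ rfl
  have hdecomp : ∀ a ∈ Submodule.span 𝕜 (Set.range X), ∃ c : 𝕜,
      ∃ s ∈ Submodule.span 𝕜 (Set.range x), a = c • 1 + (s : C(OrdInterval α, 𝕜)) := by
    intro a ha
    induction ha using Submodule.span_induction with
    | mem a ha =>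
      obtain ⟨_ | i, rfl⟩ := ha
      · exact ⟨1, 0, Submodule.zero_mem _, by simp [X]⟩
      · exact ⟨0, x i, Submodule.subset_span ⟨i, rfl⟩, by simp [X]⟩
    | zero => exact ⟨0, 0, Submodule.zero_mem _, by simp⟩
    | add a b _ _ ha hb =>
      obtain ⟨c, s, hs, rfl⟩ := ha
      obtain ⟨d, r, hr, rfl⟩ := hb
      exact ⟨c + d, s + r, Submodule.add_mem _ hs hr, by
        rw [add_smul, Submodule.coe_add]
        abel⟩
    | smul k a _ ha =>
      obtain ⟨c, s, hs, rfl⟩ := ha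
      exact ⟨k * c, k • s, Submodule.smul_mem _ _ hs, by
        rw [smul_add, mul_smul, Submodule.coe_smul]⟩
  have hg : (g : C(OrdInterval α, 𝕜)) ∈ A.topologicalClosure := hdense ▸ StarSubalgebra.mem_top
  obtain ⟨a, ha, hga⟩ := Metric.mem_closure_iff.1 hg (ε / 2) (by positivity)
  obtain ⟨c, s, hs, rfl⟩ := hdecomp a ha
  refine ⟨s, hs, ?_⟩
  rw [dist_eq_norm] at hga
  -- At the top point both `g` and `s` vanish, so `c` itself is bounded by the error and can be
  -- dropped at the cost of another `ε / 2`.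
  have hc : ‖c‖ < ε / 2 := by
    refine lt_of_le_of_lt ?_ hga
    have := ContinuousMap.norm_coe_le_norm
      ((g : C(OrdInterval α, 𝕜)) - (c • 1 + (s : C(OrdInterval α, 𝕜)))) τ
    simpa [hvanish] using this
  have : ((g - s : C0 𝕜 α) : C(OrdInterval α, 𝕜)) =
      ((g : C(OrdInterval α, 𝕜)) - (c • 1 + (s : C(OrdInterval α, 𝕜)))) + c • 1 := by
    rw [Submodule.coe_sub]
    abel
  calc ‖g - s‖ = ‖((g - s : C0 𝕜 α) : C(OrdInterval α, 𝕜))‖ := rfl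
    _ ≤ ‖(g : C(OrdInterval α, 𝕜)) - (c • 1 + (s : C(OrdInterval α, 𝕜)))‖
        + ‖c • (1 : C(OrdInterval α, 𝕜))‖ := by
      rw [this]
      exact norm_add_le _ _
    _ ≤ ‖(g : C(OrdInterval α, 𝕜)) - (c • 1 + (s : C(OrdInterval α, 𝕜)))‖ + ‖c‖ := by
      gcongr
      rw [norm_smul]
      refine mul_le_of_le_one_right (norm_nonneg _) ?_
      exact (ContinuousMap.norm_le _ zero_le_one).2 fun _ => by simp
    _ < ε := by linarith

/-- The functional `δ n` is the evaluation at the ordinal `t n`; these ordinals exhaust the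
interval, so the evaluations are norming. -/
theorem exists_isTreeBasis {α : Ordinal.{0}} {x : ℕ → C0 𝕜 α} (hx : IsStandardBasisC0 𝕜 α x) :
    ∃ Γ δ, IsTreeBasis (𝕜 := 𝕜) Γ x δ := by
  classical
  obtain ⟨f, hf, hxf⟩ := hx
  obtain ⟨Γ, t, h⟩ := exists_isTreeFamily hf
  have hmem : ∀ n, t n ∈ Set.Icc 1 (ω ^ α) := fun n =>
    ⟨Order.one_le_iff_pos.2 (h.mem n).1, (h.mem n).2⟩
  refine ⟨Γ, fun n => LinearMap.mkContinuous
    { toFun := fun g : C0 𝕜 α => (g : C(OrdInterval α, 𝕜)) ⟨t n, hmem n⟩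
      map_add' := fun _ _ => rfl
      map_smul' := fun _ _ => rfl } 1 fun g => ?_, ?_, ?_, ?_, ?_⟩
  · rw [one_mul]
    exact ContinuousMap.norm_coe_le_norm (g : C(OrdInterval α, 𝕜)) _
  · intro n i
    exact (hxf i _).trans (h.apply_eq _ _)
  · intro n g
    exact ContinuousMap.norm_coe_le_norm (g : C(OrdInterval α, 𝕜)) _
  · intro g C hC
    refine (ContinuousMap.norm_le _ ((norm_nonneg _).trans (hC 0))).2 fun ρ => ?_
    have : (ρ : Ordinal.{0}) ∈ Set.range t := by
      rw [h.range_eq]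
      exact ⟨zero_lt_one.trans_le ρ.2.1, ρ.2.2⟩
    obtain ⟨n, hn⟩ := this
    have hρ : ρ = ⟨t n, hmem n⟩ := Subtype.ext hn.symm
    rw [hρ]
    exact hC n
  · refine eq_top_iff.2 fun g _ => Metric.mem_closure_iff.2 fun ε hε => ?_
    obtain ⟨s, hs, hgs⟩ := h.exists_mem_span_norm_sub_lt hxf g hε
    exact ⟨s, hs, (dist_eq_norm g s).trans_lt hgs⟩

end

/-! ### Limits along the children of a node. -/

namespace RankedTree

/-- The children of `n` along which the rank tends to the rank of `n`, in the sense that it is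
eventually at least `β` for each `β < rank n`. -/
def childFilter (Γ : RankedTree) (n : ℕ) : Filter ℕ :=
  ⨅ β : Set.Iio (Γ.rank n), cofinite ⊓ 𝓟 {c | 0 < c ∧ Γ.parent c = n ∧ β ≤ Γ.rank c}

variable {Γ : RankedTree} {n : ℕ}

/-- The infima are directed in `β` and each filter is proper by `infinite_children`. Thus a single
filter, fixed before the game, provides children of rank at least `β` for every `β < rank n` at
once. -/
theorem childFilter_neBot (hn : 0 < Γ.rank n) : (Γ.childFilter n).NeBot := by
  have : Nonempty (Set.Iio (Γ.rank n)) := ⟨⟨0, hn⟩⟩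
  refine iInf_neBot_of_directed (Antitone.directed_ge fun β β' hβ => ?_) fun β => ?_
  · exact inf_le_inf_left _ (principal_mono.2 fun c hc => ⟨hc.1, hc.2.1, le_trans hβ hc.2.2⟩)
  · exact (Γ.infinite_children n β β.2).cofinite_inf_principal_neBot

theorem childFilter_le {β : Ordinal.{0}} (hβ : β < Γ.rank n) :
    Γ.childFilter n ≤ cofinite ⊓ 𝓟 {c | 0 < c ∧ Γ.parent c = n ∧ β ≤ Γ.rank c} :=
  iInf_le (fun β : Set.Iio (Γ.rank n) =>
    cofinite ⊓ 𝓟 {c | 0 < c ∧ Γ.parent c = n ∧ β ≤ Γ.rank c}) ⟨β, hβ⟩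

theorem eventually_childFilter {β : Ordinal.{0}} (hβ : β < Γ.rank n) :
    ∀ᶠ c in Γ.childFilter n, 0 < c ∧ Γ.parent c = n ∧ β ≤ Γ.rank c :=
  (childFilter_le hβ).trans inf_le_right (mem_principal_self _)

theorem childFilter_le_cofinite (hn : 0 < Γ.rank n) : Γ.childFilter n ≤ cofinite :=
  (childFilter_le hn).trans inf_le_left

end RankedTree

namespace IsTreeBasis

variable {𝕜 : Type u} [RCLike 𝕜] {X : Type w} [NormedAddCommGroup X] [NormedSpace 𝕜 X]
  {Γ : RankedTree} {x : ℕ → X} {δ : ℕ → StrongDual 𝕜 X} {n : ℕ}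

/-- A child `c` of `n` has the same ancestors as `n` apart from itself, so `δ c` and `δ n` agree on
`x i` unless `c = i + 1`. Boundedness and density do the rest. -/
theorem tendsto_eval_childFilter (h : IsTreeBasis Γ x δ) (hn : 0 < Γ.rank n) (f : X) :
    Tendsto (fun c => δ c f) (Γ.childFilter n) (𝓝 (δ n f)) := by
  classical
  have hf : f ∈ (Submodule.span 𝕜 (Set.range x)).topologicalClosure := h.dense ▸ Submodule.mem_top
  have := tendsto_zero_of_mem_closure_span (l := Γ.childFilter n) (L := fun c => δ c - δ n) (C := 2)
    (fun c z => ?_) ?_ hf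
  · simpa using this.add_const (δ n f)
  · have h1 := h.norm_apply_le c z
    have h2 := h.norm_apply_le n z
    have h3 := norm_sub_le (δ c z) (δ n z)
    change ‖δ c z - δ n z‖ ≤ _
    linarith
  · rintro _ ⟨i, rfl⟩
    refine tendsto_const_nhds.congr' ?_
    filter_upwards [RankedTree.eventually_childFilter hn,
      RankedTree.childFilter_le_cofinite hn (Set.finite_singleton (i + 1)).compl_mem_cofinite]
      with c hc hci
    have hne : i + 1 ≠ c := fun hh => hci hh.symm
    change 0 = δ c (x i) - δ n (x i)
    rw [h.apply_eq, h.apply_eq, RankedTree.anc_iff (n := c), hc.2.1, or_iff_right hne, sub_self]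

/-- The basis vectors at the children of a node form a weakly null family. -/
theorem tendsto_apply_childFilter (h : IsTreeBasis Γ x δ) (hn : 0 < Γ.rank n)
    (f : StrongDual 𝕜 X) : Tendsto (fun c => f (x (c - 1))) (Γ.childFilter n) (𝓝 0) := by
  classical
  let K : Set ℕ := {c | 0 < c ∧ Γ.parent c = n}
  -- Different children of `n` have no common descendant, so their basis vectors behave like unit
  -- vectors of `c₀`; hence the values of `f` on them are absolutely summable.
  have hunique : ∀ m, ∀ c ∈ K, ∀ d ∈ K, Γ.Anc c m → Γ.Anc d m → c = d := by
    intro m c hc d hd hcm hdm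
    rcases hcm.total hdm with hcd | hcd
    · rcases RankedTree.anc_iff.1 hcd with rfl | hcd
      · rfl
      · rw [hd.2, ← hc.2] at hcd
        exact absurd hcd (RankedTree.not_anc_parent hc.1)
    · rcases RankedTree.anc_iff.1 hcd with rfl | hcd
      · rfl
      · rw [hc.2, ← hd.2] at hcd
        exact absurd hcd (RankedTree.not_anc_parent hd.1)
  choose θ hθ hθf using fun c : ℕ => RCLike.exists_norm_eq_mul_self (f (x (c - 1)))
  have hsum : ∀ s : Finset K, ∑ c ∈ s, ‖f (x (c - 1))‖ ≤ ‖f‖ := by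
    intro s
    have hnorm : ‖∑ c ∈ s, θ c • x (c - 1)‖ ≤ 1 := by
      refine h.norm_le _ _ fun m => ?_
      have hδ : ∀ c : K, δ m (x (c - 1)) = if Γ.Anc c m then 1 else 0 := fun c => by
        rw [h.apply_eq, Nat.sub_add_cancel c.2.1]
      simp only [map_sum, map_smul, hδ]
      by_cases hex : ∃ c ∈ s, Γ.Anc c m
      · obtain ⟨c, hcs, hc⟩ := hex
        rw [Finset.sum_eq_single_of_mem c hcs]
        · simp [hc, hθ]
        · intro d _ hdc
          rw [if_neg fun hd => hdc (Subtype.ext (hunique m _ d.2 _ c.2 hd hc)), smul_zero]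
      · push Not at hex
        rw [Finset.sum_eq_zero fun c hc => by rw [if_neg (hex c hc), smul_zero]]
        simp
    have heq : ((∑ c ∈ s, ‖f (x (c - 1))‖ : ℝ) : 𝕜) = f (∑ c ∈ s, θ c • x (c - 1)) := by
      rw [map_sum]
      rw [RCLike.ofReal_sum]
      exact Finset.sum_congr rfl fun c _ => by
        rw [map_smul, smul_eq_mul]
        exact hθf c
    calc ∑ c ∈ s, ‖f (x (c - 1))‖ = ‖((∑ c ∈ s, ‖f (x (c - 1))‖ : ℝ) : 𝕜)‖ := by
          rw [RCLike.norm_ofReal, abs_of_nonneg (Finset.sum_nonneg fun _ _ => norm_nonneg _)]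
      _ ≤ ‖f‖ * ‖∑ c ∈ s, θ c • x (c - 1)‖ := heq ▸ f.le_opNorm _
      _ ≤ ‖f‖ := mul_le_of_le_one_right (norm_nonneg _) hnorm
  have hsummable : Summable fun c : K => ‖f (x (c - 1))‖ :=
    summable_of_sum_le (fun _ => norm_nonneg _) hsum
  rw [tendsto_zero_iff_norm_tendsto_zero, Metric.tendsto_nhds]
  intro ε hε
  have hfin := (Metric.tendsto_nhds.1 hsummable.tendsto_cofinite_zero ε hε)
  rw [eventually_cofinite] at hfin
  filter_upwards [RankedTree.eventually_childFilter hn,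
    RankedTree.childFilter_le_cofinite hn (hfin.image Subtype.val).compl_mem_cofinite] with c hc hcf
  by_contra hcon
  exact hcf ⟨⟨c, hc.1, hc.2.1⟩, hcon, rfl⟩

end IsTreeBasis

/-! ### Weak-star limits and the extension of the evaluations to `Y`. -/

section

variable {𝕜 : Type u} [RCLike 𝕜] {Y : Type v} [NormedAddCommGroup Y] [NormedSpace 𝕜 Y]

/-- Bounded families of functionals have weak-star limits along ultrafilters. -/
theorem exists_tendsto_of_ultrafilter {ι : Type*} (U : Ultrafilter ι) {g : ι → StrongDual 𝕜 Y}
    {r : ℝ} (hg : ∀ᶠ i in (U : Filter ι), ‖g i‖ ≤ r) :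
    ∃ g' : StrongDual 𝕜 Y, ‖g'‖ ≤ r ∧ ∀ y, Tendsto (fun i => g i y) U (𝓝 (g' y)) := by
  have hK := WeakDual.isCompact_closedBall (𝕜 := 𝕜) (0 : StrongDual 𝕜 Y) r
  obtain ⟨g', hg', hle⟩ := hK.ultrafilter_le_nhds
    (U.map fun i => (StrongDual.toWeakDual (g i) : WeakDual 𝕜 Y))
    (le_principal_iff.2 (hg.mono fun i hi => by simpa using hi))
  refine ⟨WeakDual.toStrongDual g', ?_, fun y => ?_⟩
  · simpa using hg'
  · have ht : Tendsto (fun i => (StrongDual.toWeakDual (g i) : WeakDual 𝕜 Y)) U (𝓝 g') := hle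
    exact ((WeakDual.eval_continuous y).tendsto g').comp ht

/-- Pointwise convergence is uniform on the unit ball of a finite-dimensional space; it suffices to
control a basis of it. -/
theorem eventually_norm_apply_le_of_mem_span {ι : Type*} {l : Filter ι} {u : ι → StrongDual 𝕜 Y}
    (hu : ∀ y, Tendsto (fun i => u i y) l (𝓝 0)) (b : Finset Y) {η : ℝ} (hη : 0 < η) :
    ∀ᶠ i in l, ∀ β ∈ Submodule.span 𝕜 (b : Set Y), ‖u i β‖ ≤ η * ‖β‖ := by
  have : FiniteDimensional 𝕜 (Submodule.span 𝕜 (b : Set Y)) :=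
    FiniteDimensional.span_finset 𝕜 b
  let v := Module.finBasis 𝕜 (Submodule.span 𝕜 (b : Set Y))
  obtain ⟨C, hC, hCv⟩ := v.exists_opNorm_le (F := 𝕜)
  have hev : ∀ᶠ i in l, ∀ j, ‖u i (v j)‖ ≤ η / C := by
    refine eventually_all.2 fun j => ?_
    have := (Metric.tendsto_nhds.1 (hu (v j))) (η / C) (by positivity)
    filter_upwards [this] with i hi
    rw [dist_zero_right] at hi
    exact hi.le
  filter_upwards [hev] with i hi β hβ
  have hop := hCv (u := (u i).comp (Submodule.subtypeL _)) (by positivity) hi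
  rw [mul_div_cancel₀ _ hC.ne'] at hop
  exact ((u i).comp (Submodule.subtypeL _)).le_of_opNorm_le hop ⟨β, hβ⟩

end

namespace IsTreeBasis

variable {𝕜 : Type u} [RCLike 𝕜] {X : Type w} [NormedAddCommGroup X] [NormedSpace 𝕜 X]
  {Y : Type v} [NormedAddCommGroup Y] [NormedSpace 𝕜 Y]
  {Γ : RankedTree} {x : ℕ → X} {δ : ℕ → StrongDual 𝕜 X}

/-- The evaluations at the nodes, moved to `T X`, extend to functionals on `Y` in such a way that
the functional at each node is a weak-star limit of those at the children of the node. -/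
theorem exists_extensions (h : IsTreeBasis Γ x δ) {E : Submodule 𝕜 Y} (T : X ≃L[𝕜] E) :
    ∃ g : ℕ → StrongDual 𝕜 Y, (∀ n, ‖g n‖ ≤ ‖(T.symm : E →L[𝕜] X)‖) ∧
      (∀ n f, g n (T f) = δ n f) ∧
      ∀ n, 0 < Γ.rank n → ∃ l : Filter ℕ, l.NeBot ∧ l ≤ Γ.childFilter n ∧
        ∀ y, Tendsto (fun c => g c y) l (𝓝 (g n y)) := by
  classical
  have hU : ∀ n, ∃ U : Ultrafilter ℕ, 0 < Γ.rank n → (U : Filter ℕ) ≤ Γ.childFilter n := by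
    intro n
    by_cases hn : 0 < Γ.rank n
    · have := RankedTree.childFilter_neBot hn
      exact ⟨Ultrafilter.of (Γ.childFilter n), fun _ => Ultrafilter.of_le _⟩
    · exact ⟨hyperfilter ℕ, fun hn' => absurd hn' hn⟩
  choose U hU using hU
  let r := ‖(T.symm : E →L[𝕜] X)‖
  let R : ℕ → (ℕ → StrongDual 𝕜 Y) → StrongDual 𝕜 Y → Prop := fun n g v =>
    ‖v‖ ≤ r ∧ (∀ f, v (T f) = δ n f) ∧
      (0 < Γ.rank n → ∀ y, Tendsto (fun c => g c y) (U n) (𝓝 (v y)))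
  have hchild : ∀ n, 0 < Γ.rank n → ∀ᶠ c in (U n : Filter ℕ), Γ.rank c < Γ.rank n := by
    intro n hn
    filter_upwards [hU n hn (RankedTree.eventually_childFilter hn)] with c hc
    exact hc.2.1 ▸ Γ.rank_lt c hc.1
  -- At positive rank an ultrafilter limit of the children's functionals works, since it restricts
  -- to the limit of `δ c`, which is `δ n`. At rank zero Hahn–Banach suffices.
  have step : ∀ n (g : ℕ → StrongDual 𝕜 Y),
      (∀ c, Γ.rank c < Γ.rank n → ‖g c‖ ≤ r ∧ ∀ f, g c (T f) = δ c f) → ∃ v, R n g v := by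
    intro n g hg
    by_cases hn : 0 < Γ.rank n
    · obtain ⟨v, hv, hlim⟩ := exists_tendsto_of_ultrafilter (U n) (g := g) (r := r)
        ((hchild n hn).mono fun c hc => (hg c hc).1)
      refine ⟨v, hv, fun f => ?_, fun _ => hlim⟩
      refine tendsto_nhds_unique (hlim (T f)) ?_
      refine ((h.tendsto_eval_childFilter hn f).mono_left (hU n hn)).congr' ?_
      exact (hchild n hn).mono fun c hc => ((hg c hc).2 f).symm
    · obtain ⟨v, hv, hnorm⟩ := exists_extension_norm_eq E ((δ n).comp (T.symm : E →L[𝕜] X))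
      refine ⟨v, ?_, fun f => ?_, fun hn' => absurd hn' hn⟩
      · rw [hnorm]
        refine ContinuousLinearMap.opNorm_le_bound _ (norm_nonneg _) fun z => ?_
        exact (h.norm_apply_le n _).trans ((T.symm : E →L[𝕜] X).le_opNorm z)
      · rw [hv]
        simp
  have hwf : WellFounded fun c n => Γ.rank c < Γ.rank n := InvImage.wf Γ.rank wellFounded_lt
  -- Recursion on the rank. The default `0` at nodes of rank not below that of `n` is harmless,
  -- because `U n`-almost all nodes are children of `n` when `n` has positive rank.
  let g : ℕ → StrongDual 𝕜 Y := hwf.fix fun n ih => Classical.epsilon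
    (R n fun c => if hc : Γ.rank c < Γ.rank n then ih c hc else 0)
  have hg_eq : ∀ n, g n = Classical.epsilon
      (R n fun c => if Γ.rank c < Γ.rank n then g c else 0) := by
    intro n
    exact (hwf.fix_eq _ n).trans (by simp only [dite_eq_ite]; rfl)
  have hg : ∀ n, R n (fun c => if Γ.rank c < Γ.rank n then g c else 0) (g n) := by
    intro n
    induction n using hwf.induction with
    | _ n ih =>
      have hspec := Classical.epsilon_spec
        (step n (fun c => if Γ.rank c < Γ.rank n then g c else 0) fun c hc => by
          simp only [if_pos hc]
          exact ⟨(ih c hc).1, (ih c hc).2.1⟩)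
      rwa [← hg_eq] at hspec
  refine ⟨g, fun n => (hg n).1, fun n => (hg n).2.1, fun n hn => ⟨U n, inferInstance, hU n hn, ?_⟩⟩
  intro y
  refine ((hg n).2.2 hn y).congr' ?_
  filter_upwards [hchild n hn] with c hc
  rw [if_pos hc]

end IsTreeBasis

/-! ### Windows of the basis of `Y` and functionals small on them. -/

namespace ReproducibleGame

section Window

variable {𝕜 : Type u} [RCLike 𝕜] {Y : Type v} [NormedAddCommGroup Y] [NormedSpace 𝕜 Y]
  (y : SchauderBasis 𝕜 Y) {l r n : ℕ} {β : Y}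

theorem proj_eq_self_of_mem_window (hβ : β ∈ window 𝕜 y l r) (hn : r ≤ n) : y.proj n β = β := by
  induction hβ using Submodule.span_induction with
  | mem β hβ =>
    obtain ⟨i, hi, rfl⟩ := hβ
    rw [y.proj_apply_basis_mem, if_pos (hi.2.trans_le hn)]
  | zero => exact map_zero _
  | add a b _ _ ha hb => rw [map_add, ha, hb]
  | smul c a _ ha => rw [map_smul, ha]

theorem proj_eq_zero_of_mem_window (hβ : β ∈ window 𝕜 y l r) (hn : n ≤ l) : y.proj n β = 0 := by
  induction hβ using Submodule.span_induction with
  | mem β hβ =>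
    obtain ⟨i, hi, rfl⟩ := hβ
    rw [y.proj_apply_basis_mem, if_neg (hn.trans hi.1).not_gt]
  | zero => exact map_zero _
  | add a b _ _ ha hb => rw [map_add, ha, hb, add_zero]
  | smul c a _ ha => rw [map_smul, ha, smul_zero]

theorem proj_sub_proj_mem_window (hlr : l ≤ r) (z : Y) :
    y.proj r z - y.proj l z ∈ window 𝕜 y l r := by
  rw [y.proj_apply, y.proj_apply, ← Finset.sum_Ico_eq_sub _ hlr]
  refine Submodule.sum_mem _ fun i hi => Submodule.smul_mem _ _ (Submodule.subset_span ⟨i, ?_, rfl⟩)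
  simpa using hi

/-- Vectors chosen from separated windows are recovered from their combinations by differences
of the basis projections. -/
theorem proj_sub_proj_mem_span {b : ℕ → Finset Y} {L I : ℕ → ℕ} (hLI : ∀ k, L k ≤ I k)
    (hIL : ∀ k, I k ≤ L (k + 1)) (hb : ∀ k, ∀ β ∈ b k, β ∈ window 𝕜 y (L k) (I k))
    {z : Y} (hz : z ∈ Submodule.span 𝕜 (⋃ k, (b k : Set Y))) :
    (∀ k, y.proj (I k) z - y.proj (L k) z ∈ Submodule.span 𝕜 (b k : Set Y)) ∧
      ∀ᶠ N in atTop, z = ∑ k ∈ Finset.range N, (y.proj (I k) z - y.proj (L k) z) := by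
  have hI : Monotone I := monotone_nat_of_le_succ fun k => (hIL k).trans (hLI (k + 1))
  have hlt : ∀ {j k}, j < k → I j ≤ L k := by
    intro j k hjk
    obtain ⟨d, rfl⟩ := Nat.exists_eq_add_of_lt hjk
    exact (hI (Nat.le_add_right j d)).trans (hIL (j + d))
  induction hz using Submodule.span_induction with
  | mem β hβ =>
    obtain ⟨j, hj⟩ := Set.mem_iUnion.1 hβ
    have key : ∀ k, y.proj (I k) β - y.proj (L k) β = if k = j then β else 0 := by
      intro k
      have hw := hb j β hj
      rcases lt_trichotomy k j with h | rfl | h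
      · rw [if_neg h.ne, proj_eq_zero_of_mem_window y hw (hlt h),
          proj_eq_zero_of_mem_window y hw ((hLI k).trans (hlt h)), sub_zero]
      · rw [if_pos rfl, proj_eq_self_of_mem_window y hw le_rfl,
          proj_eq_zero_of_mem_window y hw le_rfl, sub_zero]
      · rw [if_neg h.ne', proj_eq_self_of_mem_window y hw ((hlt h).trans (hLI k)),
          proj_eq_self_of_mem_window y hw (hlt h), sub_self]
    refine ⟨fun k => ?_, ?_⟩
    · rw [key]
      split_ifs with h
      · exact Submodule.subset_span (h ▸ hj)
      · exact Submodule.zero_mem _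
    · filter_upwards [eventually_gt_atTop j] with N hN
      rw [Finset.sum_congr rfl fun k _ => key k, Finset.sum_ite_eq', if_pos (Finset.mem_range.2 hN)]
  | zero => exact ⟨fun k => by simp, Eventually.of_forall fun N => by simp⟩
  | add a b _ _ ha hb =>
    have hab : ∀ k, y.proj (I k) (a + b) - y.proj (L k) (a + b) =
        (y.proj (I k) a - y.proj (L k) a) + (y.proj (I k) b - y.proj (L k) b) := fun k => by
      rw [map_add, map_add]
      abel
    refine ⟨fun k => hab k ▸ Submodule.add_mem _ (ha.1 k) (hb.1 k), ?_⟩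
    filter_upwards [ha.2, hb.2] with N hNa hNb
    rw [Finset.sum_congr rfl fun k _ => hab k, Finset.sum_add_distrib, ← hNa, ← hNb]
  | smul c a _ ha =>
    have hca : ∀ k, y.proj (I k) (c • a) - y.proj (L k) (c • a) =
        c • (y.proj (I k) a - y.proj (L k) a) := fun k => by
      rw [map_smul, map_smul, smul_sub]
    refine ⟨fun k => hca k ▸ Submodule.smul_mem _ _ (ha.1 k), ?_⟩
    filter_upwards [ha.2] with N hNa
    rw [Finset.sum_congr rfl fun k _ => hca k, ← Finset.smul_sum, ← hNa]

/-- A functional that is geometrically small on the separated windows is small on their span. -/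
theorem norm_apply_le_of_mem_span_iUnion {b : ℕ → Finset Y} {L I : ℕ → ℕ} (hLI : ∀ k, L k ≤ I k)
    (hIL : ∀ k, I k ≤ L (k + 1)) (hb : ∀ k, ∀ β ∈ b k, β ∈ window 𝕜 y (L k) (I k))
    {K κ : ℝ} (hK : ∀ n, ‖y.proj n‖ ≤ K) (hκ : 0 ≤ κ) {u : StrongDual 𝕜 Y}
    (hu : ∀ k, ∀ β ∈ Submodule.span 𝕜 (b k : Set Y), ‖u β‖ ≤ κ * (1 / 2) ^ k * ‖β‖)
    {z : Y} (hz : z ∈ Submodule.span 𝕜 (⋃ k, (b k : Set Y))) : ‖u z‖ ≤ 4 * K * κ * ‖z‖ := by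
  obtain ⟨hmem, hsum⟩ := proj_sub_proj_mem_span y hLI hIL hb hz
  obtain ⟨N, hN⟩ := hsum.exists
  have hK0 : 0 ≤ K := (norm_nonneg _).trans (hK 0)
  -- The difference of two basis projections costs `2 * K`; the geometric series below contributes
  -- the other factor `2`.
  have hterm : ∀ k, ‖u (y.proj (I k) z - y.proj (L k) z)‖ ≤ 2 * K * κ * ‖z‖ * (1 / 2) ^ k := by
    intro k
    have h1 := (y.proj (I k)).le_of_opNorm_le (hK _) z
    have h2 := (y.proj (L k)).le_of_opNorm_le (hK _) z
    have h3 : ‖y.proj (I k) z - y.proj (L k) z‖ ≤ 2 * K * ‖z‖ := by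
      linarith [norm_sub_le (y.proj (I k) z) (y.proj (L k) z)]
    calc _ ≤ κ * (1 / 2) ^ k * ‖y.proj (I k) z - y.proj (L k) z‖ := hu k _ (hmem k)
      _ ≤ κ * (1 / 2) ^ k * (2 * K * ‖z‖) := by gcongr
      _ = _ := by ring
  have hgeom : ∑ k ∈ Finset.range N, (1 / 2 : ℝ) ^ k ≤ 2 := sum_geometric_two_le N
  calc ‖u z‖ = ‖∑ k ∈ Finset.range N, u (y.proj (I k) z - y.proj (L k) z)‖ := by
        rw [← map_sum, ← hN]
    _ ≤ ∑ k ∈ Finset.range N, 2 * K * κ * ‖z‖ * (1 / 2) ^ k :=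
        norm_sum_le_of_le _ fun k _ => hterm k
    _ = 2 * K * κ * ‖z‖ * ∑ k ∈ Finset.range N, (1 / 2 : ℝ) ^ k := by rw [Finset.mul_sum]
    _ ≤ 2 * K * κ * ‖z‖ * 2 := by gcongr
    _ = _ := by ring

end Window

/-! ### The projection read off from the extended evaluations. -/

section Projection

variable {𝕜 : Type u} [RCLike 𝕜] {X : Type w} [NormedAddCommGroup X] [NormedSpace 𝕜 X]
  {Y : Type v} [NormedAddCommGroup Y] [NormedSpace 𝕜 Y]
  {Γ : RankedTree} {x : ℕ → X} {δ : ℕ → StrongDual 𝕜 X} {E : Submodule 𝕜 Y} {T : X ≃L[𝕜] E}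
  {g : ℕ → StrongDual 𝕜 Y} {φ : ℕ → ℕ}

variable (Γ x T g φ) in
/-- The partial sums of the projection that is read off from the functionals `g`. -/
def partialProj (N : ℕ) : Y →L[𝕜] Y :=
  ∑ i ∈ Finset.range N, (g (φ (i + 1)) - g (φ (Γ.parent (i + 1)))).smulRight
    (T (x (φ (i + 1) - 1)) : Y)

theorem partialProj_apply (N : ℕ) (z : Y) : partialProj Γ x T g φ N z =
    ∑ i ∈ Finset.range N, (g (φ (i + 1)) z - g (φ (Γ.parent (i + 1))) z) •
      (T (x (φ (i + 1) - 1)) : Y) := by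
  simp [partialProj]

/-- The partial sum is the image under `T` of a combination whose branch sums telescope to
differences `g (φ n) z - g 0 z`. -/
theorem norm_partialProj_apply_le (h : IsTreeBasis Γ x δ) (hφ : Γ.IsEmbedding φ) {z : Y} {C : ℝ}
    (hC : ∀ n, ‖g (φ n) z - g 0 z‖ ≤ C) (N : ℕ) :
    ‖partialProj Γ x T g φ N z‖ ≤ ‖(T : X →L[𝕜] E)‖ * C := by
  have h1 := h.norm_sum_sub_parent_le hφ (fun n => g (φ n) z) (C := C)
    (by simpa [hφ.map_zero] using hC) N
  have h2 : partialProj Γ x T g φ N z = ((T : X →L[𝕜] E) (∑ i ∈ Finset.range N,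
      (g (φ (i + 1)) z - g (φ (Γ.parent (i + 1))) z) • x (φ (i + 1) - 1)) : E) := by
    rw [partialProj_apply]
    simp
  rw [h2]
  exact ((T : X →L[𝕜] E).le_opNorm _).trans (by gcongr)

theorem partialProj_apply_basis (h : IsTreeBasis Γ x δ) (hφ : Γ.IsEmbedding φ)
    (hgT : ∀ n f, g n (T f) = δ n f) {j N : ℕ} (hjN : j < N) :
    partialProj Γ x T g φ N (T (x (φ (j + 1) - 1))) = T (x (φ (j + 1) - 1)) := by
  rw [partialProj_apply]
  simp only [hgT, h.apply_sub_apply_parent hφ]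
  simp [hjN]

/-- The partial sums are uniformly bounded, so convergence is only needed on the generators: on `S`
they are eventually constant by biorthogonality, on `B` the series is dominated by a geometric one
through `hconv`. -/
theorem exists_projection [CompleteSpace Y] (h : IsTreeBasis Γ x δ) (hφ : Γ.IsEmbedding φ)
    (hgT : ∀ n f, g n (T f) = δ n f) (hg : ∀ n, ‖g n‖ ≤ ‖(T.symm : E →L[𝕜] X)‖)
    {b : ℕ → Finset Y} {κ ε₀ : ℝ}
    (hconv : ∀ n k, k ≤ n → ∀ β ∈ Submodule.span 𝕜 (b k : Set Y),
      ‖(g (φ (n + 1)) - g (φ (Γ.parent (n + 1)))) β‖ ≤ κ * (1 / 2) ^ n * ‖β‖)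
    (hsmall : ∀ n, ∀ z ∈ Submodule.span 𝕜 (⋃ k, (b k : Set Y)),
      ‖(T : X →L[𝕜] E)‖ * ‖(g (φ n) - g 0) z‖ ≤ ε₀ * ‖z‖)
    {S B : Set Y} (hS : S = Set.range fun n => (T (x (φ (n + 1) - 1)) : Y))
    (hB : B = ⋃ k, (b k : Set Y)) :
    ∃ P : (Submodule.span 𝕜 (B ∪ S)).topologicalClosure →L[𝕜] Y,
      (∀ z, P z ∈ (Submodule.span 𝕜 S).topologicalClosure) ∧
      (∀ z : (Submodule.span 𝕜 (B ∪ S)).topologicalClosure,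
        (z : Y) ∈ (Submodule.span 𝕜 S).topologicalClosure → P z = z) ∧
      ‖P‖ ≤ ‖(T : X →L[𝕜] E)‖ * ‖(T.symm : E →L[𝕜] X)‖ * 2 ∧
      ∀ z : (Submodule.span 𝕜 (B ∪ S)).topologicalClosure,
        (z : Y) ∈ (Submodule.span 𝕜 B).topologicalClosure → ‖P z‖ ≤ ε₀ * ‖z‖ := by
  set Q := partialProj Γ x T g φ with hQ
  set t := ‖(T : X →L[𝕜] E)‖ with ht
  set r := ‖(T.symm : E →L[𝕜] X)‖ with hr
  have ht0 : 0 ≤ t := norm_nonneg _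
  have hr0 : 0 ≤ r := norm_nonneg _
  -- Off `T X` the functional `g 0` need not vanish, so the telescoped difference costs `2 * r`;
  -- this is the constant `D = 2`.
  have hbound : ∀ N z, ‖Q N z‖ ≤ t * r * 2 * ‖z‖ := by
    intro N z
    refine (norm_partialProj_apply_le h hφ (C := 2 * r * ‖z‖) (fun n => ?_) N).trans_eq (by ring)
    have h1 := (g (φ n)).le_of_opNorm_le (hg _) z
    have h2 := (g 0).le_of_opNorm_le (hg _) z
    linarith [norm_sub_le (g (φ n) z) (g 0 z)]
  have hcauchy_gen : ∀ z ∈ B ∪ S, CauchySeq fun N => Q N z := by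
    rintro z (hz | hz)
    · rw [hB] at hz
      obtain ⟨k, hk⟩ := Set.mem_iUnion.1 hz
      have hsum : Summable fun n => (g (φ (n + 1)) z - g (φ (Γ.parent (n + 1))) z) •
          (T (x (φ (n + 1) - 1)) : Y) := by
        refine Summable.of_norm_bounded_eventually_nat
          (g := fun n => κ * ‖z‖ * t * (1 / 2 : ℝ) ^ n)
          (summable_geometric_two.mul_left _) ?_
        filter_upwards [eventually_ge_atTop k] with n hn
        have h1 := hconv n k hn z (Submodule.subset_span hk)
        have h2 : ‖(T (x (φ (n + 1) - 1)) : Y)‖ ≤ t := by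
          simpa [h.norm_basis] using (T : X →L[𝕜] E).le_opNorm (x (φ (n + 1) - 1))
        rw [norm_smul]
        calc _ ≤ κ * (1 / 2) ^ n * ‖z‖ * t :=
              mul_le_mul h1 h2 (norm_nonneg _) ((norm_nonneg _).trans h1)
          _ = _ := by ring
      have := hsum.hasSum.tendsto_sum_nat.cauchySeq
      simpa only [hQ, partialProj_apply] using this
    · rw [hS] at hz
      obtain ⟨j, rfl⟩ := hz
      refine Tendsto.cauchySeq (x := (T (x (φ (j + 1) - 1)) : Y)) (tendsto_const_nhds.congr' ?_)
      filter_upwards [eventually_gt_atTop j] with N hN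
      exact (partialProj_apply_basis h hφ hgT hN).symm
  have hcauchy : ∀ z : (Submodule.span 𝕜 (B ∪ S)).topologicalClosure,
      CauchySeq fun N => Q N (z : Y) := by
    intro z
    rw [cauchySeq_iff_tendsto_dist_atTop_0]
    -- The Cauchy property is convergence to zero of `Q n.1 - Q n.2` over pairs of indices, and in
    -- this form it passes to the closed span.
    have := tendsto_zero_of_mem_closure_span (l := (atTop : Filter (ℕ × ℕ)))
      (L := fun n => Q n.1 - Q n.2) (C := 2 * (t * r * 2)) (fun n z => ?_) (fun z hz => ?_) z.2
    · simpa [dist_eq_norm] using this.norm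
    · change ‖Q n.1 z - Q n.2 z‖ ≤ _
      linarith [norm_sub_le (Q n.1 z) (Q n.2 z), hbound n.1 z, hbound n.2 z]
    · have := cauchySeq_iff_tendsto_dist_atTop_0.1 (hcauchy_gen z hz)
      rw [tendsto_zero_iff_norm_tendsto_zero]
      simpa [dist_eq_norm] using this
  choose lim hlim using fun z => cauchySeq_tendsto_of_complete (hcauchy z)
  let P₀ : (Submodule.span 𝕜 (B ∪ S)).topologicalClosure →ₗ[𝕜] Y :=
    { toFun := lim
      map_add' := fun a b => tendsto_nhds_unique (hlim (a + b)) <| by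
        simpa using (hlim a).add (hlim b)
      map_smul' := fun c a => tendsto_nhds_unique (hlim (c • a)) <| by
        simpa using (hlim a).const_smul c }
  let P := P₀.mkContinuous (t * r * 2) fun z =>
    le_of_tendsto (hlim z).norm (Eventually.of_forall fun N => hbound N z)
  have hP : ∀ z : (Submodule.span 𝕜 (B ∪ S)).topologicalClosure,
      Tendsto (fun N => Q N (z : Y)) atTop (𝓝 (P z)) := hlim
  refine ⟨P, fun z => ?_, fun z hz => ?_, ?_, fun z hz => ?_⟩
  · refine (Submodule.isClosed_topologicalClosure _).mem_of_tendsto (hP z)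
      (Eventually.of_forall fun N => Submodule.le_topologicalClosure _ ?_)
    rw [hQ, partialProj_apply]
    refine Submodule.sum_mem _ fun i _ => Submodule.smul_mem _ _ (Submodule.subset_span ?_)
    rw [hS]
    exact ⟨i, rfl⟩
  · refine tendsto_nhds_unique (hP z) ?_
    have := tendsto_zero_of_mem_closure_span (l := atTop)
      (L := fun N => Q N - ContinuousLinearMap.id 𝕜 Y) (C := t * r * 2 + 1)
      (fun n z => ?_) (fun z hz => ?_) hz
    · simpa using this.add_const (z : Y)
    · change ‖Q n z - z‖ ≤ _
      linarith [norm_sub_le (Q n z) z, hbound n z]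
    · rw [hS] at hz
      obtain ⟨j, rfl⟩ := hz
      refine tendsto_const_nhds.congr' ?_
      filter_upwards [eventually_gt_atTop j] with N hN
      change 0 = Q N _ - _
      rw [hQ, partialProj_apply_basis h hφ hgT hN]
      exact (sub_self _).symm
  · exact P₀.mkContinuous_norm_le (by positivity) _
  · have hspan : ∀ N, ∀ z ∈ Submodule.span 𝕜 B, ‖Q N z‖ ≤ ε₀ * ‖z‖ := by
      intro N z hz
      rw [hB] at hz
      rcases ht0.eq_or_lt with ht' | ht'
      · have h1 := hbound N z
        have h2 := hsmall 0 z hz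
        rw [← ht', zero_mul] at h2
        rw [← ht'] at h1
        linarith
      · refine (norm_partialProj_apply_le h hφ (C := ε₀ * ‖z‖ / t) (fun n => ?_) N).trans_eq ?_
        · rw [le_div_iff₀' ht']
          exact hsmall n z hz
        · exact mul_div_cancel₀ _ ht'.ne'
    have hclosed : ∀ N, ∀ z ∈ (Submodule.span 𝕜 B).topologicalClosure, ‖Q N z‖ ≤ ε₀ * ‖z‖ := by
      intro N z hz
      have : IsClosed {z : Y | ‖Q N z‖ ≤ ε₀ * ‖z‖} :=
        isClosed_le (Q N).continuous.norm (continuous_const.mul continuous_norm)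
      exact closure_minimal (fun z hz => hspan N z hz) this hz
    exact le_of_tendsto (hP z).norm (Eventually.of_forall fun N => hclosed N z hz)

end Projection

end ReproducibleGame

/-! ### Building the embedding node by node. -/

namespace RankedTree

/-- The map of the nodes that is chosen step by step: in step `k` the image of the node `k + 1` is
chosen by the condition `Q k`, which may refer to the images of `k` and of the parent of `k + 1`. -/
noncomputable def greedyMap (Γ : RankedTree) (Q : ℕ → ℕ → ℕ → ℕ → Prop) : ℕ → ℕ
  | 0 => 0
  | k + 1 => Classical.epsilon (Q k (greedyMap Γ Q k) (greedyMap Γ Q (Γ.parent (k + 1))))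
decreasing_by
  · exact k.lt_succ_self
  · exact Γ.parent_lt _ k.succ_pos

theorem greedyMap_zero (Γ : RankedTree) (Q : ℕ → ℕ → ℕ → ℕ → Prop) : Γ.greedyMap Q 0 = 0 := by
  rw [greedyMap]

theorem greedyMap_succ (Γ : RankedTree) (Q : ℕ → ℕ → ℕ → ℕ → Prop) (k : ℕ) :
    Γ.greedyMap Q (k + 1) =
      Classical.epsilon (Q k (Γ.greedyMap Q k) (Γ.greedyMap Q (Γ.parent (k + 1)))) := by
  rw [greedyMap]

/-- The images of nodes up to `K` use only the conditions of steps before `K`. This is what makes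
the construction a strategy, independent of future moves. -/
theorem greedyMap_congr (Γ : RankedTree) {Q Q' : ℕ → ℕ → ℕ → ℕ → Prop} {K : ℕ}
    (hQ : ∀ k < K, Q k = Q' k) : ∀ n ≤ K, Γ.greedyMap Q n = Γ.greedyMap Q' n := by
  intro n
  induction n using Nat.strong_induction_on with
  | _ n ih =>
    intro hn
    rcases n with _ | k
    · rw [greedyMap_zero, greedyMap_zero]
    · have hp := Γ.parent_lt (k + 1) k.succ_pos
      rw [greedyMap_succ, greedyMap_succ, hQ k hn, ih k k.lt_succ_self (by omega),
        ih _ hp (hp.le.trans hn)]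

end RankedTree

/-! ### The second player's strategy. -/

namespace ReproducibleGame

variable {𝕜 : Type u} [RCLike 𝕜] {X : Type w} [NormedAddCommGroup X] [NormedSpace 𝕜 X]
  {Y : Type v} [NormedAddCommGroup Y] [NormedSpace 𝕜 Y]
  {Γ : RankedTree} {x : ℕ → X} {δ : ℕ → StrongDual 𝕜 X} {E : Submodule 𝕜 Y} {T : X ≃L[𝕜] E}
  {y : SchauderBasis 𝕜 Y} {g : ℕ → StrongDual 𝕜 Y} {ε : ℕ → ℝ} {κ : ℝ}

variable (Γ x T y g ε κ) in
/-- The requirements on the node `c` that the second player picks in turn `k` as the image of the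
node `k + 1`, when the images of `k` and of the parent of `k + 1` are `m` and `q`. -/
structure IsGoodPick (p : ℕ → FirstMove 𝕜 Y) (k m q c : ℕ) : Prop where
  lt : m < c
  parent_eq : Γ.parent c = q
  rank_le : Γ.rank (k + 1) ≤ Γ.rank c
  small : ∀ d ∈ (p k).F, ‖d.1 (T (x (c - 1)))‖ * ‖(T.symm : E →L[𝕜] X)‖ < d.2
  norm_proj_lt : ‖y.proj (p k).i (T (x (c - 1)))‖ <
    min (ε (k + 1)) ‖(T.symm : E →L[𝕜] X)‖⁻¹ / 2
  close : ∀ j ≤ k, ∀ β ∈ Submodule.span 𝕜 ((p j).b : Set Y),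
    ‖(g c - g q) β‖ ≤ κ * (1 / 2) ^ k * ‖β‖

theorem isGoodPick_congr {p p' : ℕ → FirstMove 𝕜 Y} {k : ℕ} (hp : ∀ j ≤ k, p j = p' j) :
    IsGoodPick Γ x T y g ε κ p k = IsGoodPick Γ x T y g ε κ p' k := by
  have key : ∀ {p p' : ℕ → FirstMove 𝕜 Y}, (∀ j ≤ k, p j = p' j) → ∀ {m q c},
      IsGoodPick Γ x T y g ε κ p k m q c → IsGoodPick Γ x T y g ε κ p' k m q c :=
    fun hp _ _ _ h => ⟨h.lt, h.parent_eq, h.rank_le, hp k le_rfl ▸ h.small,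
      hp k le_rfl ▸ h.norm_proj_lt, fun j hj => hp j hj ▸ h.close j hj⟩
  funext m q c
  exact propext ⟨key hp, key fun j hj => (hp j hj).symm⟩

variable (x T) in
theorem symm_norm_pos (h : IsTreeBasis Γ x δ) : 0 < ‖(T.symm : E →L[𝕜] X)‖ := by
  refine norm_pos_iff.2 fun h0 => ?_
  have h1 : (T.symm : E →L[𝕜] X) (T (x 0)) = 0 := by rw [h0]; rfl
  have h2 : x 0 = 0 := by simpa using h1
  have h3 := h.norm_basis 0
  rw [h2, norm_zero] at h3
  exact zero_ne_one h3

variable (T) in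
theorem one_le_symm_norm_mul (h : IsTreeBasis Γ x δ) (i : ℕ) :
    1 ≤ ‖(T.symm : E →L[𝕜] X)‖ * ‖(T (x i) : Y)‖ := by
  have := (T.symm : E →L[𝕜] X).le_opNorm (T (x i))
  simpa [h.norm_basis] using this

/-- Each requirement holds eventually along the filter `l` of children of `q`: weak nullity gives
`small` and `norm_proj_lt`, weak-star convergence of `g c` to `g q` gives `close`, and the strict
inequality `hq` gives the rank. -/
theorem exists_isGoodPick (h : IsTreeBasis Γ x δ)
    (hlim : ∀ n, 0 < Γ.rank n → ∃ l : Filter ℕ, l.NeBot ∧ l ≤ Γ.childFilter n ∧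
      ∀ z, Tendsto (fun c => g c z) l (𝓝 (g n z)))
    (hε : ∀ k, 0 < ε k) (hκ : 0 < κ) {p : ℕ → FirstMove 𝕜 Y} {k : ℕ}
    (hp : ∀ d ∈ (p k).F, 0 < d.2) (m : ℕ) {q : ℕ} (hq : Γ.rank (k + 1) < Γ.rank q) :
    ∃ c, IsGoodPick Γ x T y g ε κ p k m q c := by
  have hq0 : 0 < Γ.rank q := zero_le.trans_lt hq
  obtain ⟨l, hl, hle, hl_lim⟩ := hlim q hq0
  have hr := symm_norm_pos x T h
  have hnull : ∀ u : StrongDual 𝕜 Y, Tendsto (fun c => u (T (x (c - 1)))) l (𝓝 0) := fun u =>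
    (h.tendsto_apply_childFilter hq0 (u.comp (E.subtypeL.comp (T : X →L[𝕜] E)))).mono_left hle
  have hsmall : ∀ᶠ c in l, ∀ d ∈ (p k).F,
      ‖d.1 (T (x (c - 1)))‖ * ‖(T.symm : E →L[𝕜] X)‖ < d.2 := by
    refine (eventually_all_finset _).2 fun d hd => ?_
    have := (hnull d.1).norm.mul_const ‖(T.symm : E →L[𝕜] X)‖
    rw [norm_zero, zero_mul] at this
    exact this.eventually_lt_const (hp d hd)
  have hproj : ∀ᶠ c in l, ‖y.proj (p k).i (T (x (c - 1)))‖ <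
      min (ε (k + 1)) ‖(T.symm : E →L[𝕜] X)‖⁻¹ / 2 := by
    have : Tendsto (fun c => y.proj (p k).i (T (x (c - 1)))) l (𝓝 0) := by
      simp only [SchauderBasis.proj_apply]
      rw [← Finset.sum_const_zero (ι := ℕ) (s := Finset.range (p k).i)]
      refine tendsto_finsetSum _ fun i _ => ?_
      simpa using (hnull (y.coord i)).smul_const (y i)
    have := this.norm
    rw [norm_zero] at this
    exact this.eventually_lt_const (half_pos (lt_min (hε _) (inv_pos.2 hr)))
  have hclose : ∀ᶠ c in l, ∀ j ≤ k, ∀ β ∈ Submodule.span 𝕜 ((p j).b : Set Y),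
      ‖(g c - g q) β‖ ≤ κ * (1 / 2) ^ k * ‖β‖ := by
    refine (eventually_all_finite (Set.finite_Iic k)).2 fun j _ => ?_
    refine eventually_norm_apply_le_of_mem_span (fun z => ?_) _ (by positivity)
    simpa using (hl_lim z).sub_const (g q z)
  have hgt : ∀ᶠ c in l, m < c :=
    (hle.trans (RankedTree.childFilter_le_cofinite hq0))
      (Nat.cofinite_eq_atTop ▸ eventually_gt_atTop m)
  have hchild := (RankedTree.eventually_childFilter hq).filter_mono hle
  obtain ⟨c, h1, h2, h3, h4, h5⟩ := (hgt.and (hchild.and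
    (hsmall.and (hproj.and hclose)))).exists
  exact ⟨c, h1, h2.2.1, h2.2.2, h3, h4, h5⟩

variable (Γ x T y g ε κ) in
/-- The images of the nodes that the second player picks against the moves `p`. -/
noncomputable def pickMap (p : ℕ → FirstMove 𝕜 Y) : ℕ → ℕ :=
  Γ.greedyMap (IsGoodPick Γ x T y g ε κ p)

theorem pickMap_congr {p p' : ℕ → FirstMove 𝕜 Y} {k : ℕ} (hp : ∀ j ≤ k, p j = p' j) :
    ∀ n ≤ k + 1, pickMap Γ x T y g ε κ p n = pickMap Γ x T y g ε κ p' n :=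
  Γ.greedyMap_congr fun _ hj => isGoodPick_congr fun i hi => hp i (hi.trans (Nat.lt_succ_iff.1 hj))

/-- This invariant keeps the construction alive: `k + 1` has smaller rank than its parent, hence
smaller rank than the image of its parent, so a good pick exists. -/
theorem rank_le_rank_pickMap (h : IsTreeBasis Γ x δ)
    (hlim : ∀ n, 0 < Γ.rank n → ∃ l : Filter ℕ, l.NeBot ∧ l ≤ Γ.childFilter n ∧
      ∀ z, Tendsto (fun c => g c z) l (𝓝 (g n z)))
    (hε : ∀ k, 0 < ε k) (hκ : 0 < κ) {p : ℕ → FirstMove 𝕜 Y} :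
    ∀ n, (∀ j < n, ∀ d ∈ (p j).F, 0 < d.2) →
      Γ.rank n ≤ Γ.rank (pickMap Γ x T y g ε κ p n) := by
  intro n
  induction n using Nat.strong_induction_on with
  | _ n ih =>
    intro hp
    rcases n with _ | k
    · rw [pickMap, RankedTree.greedyMap_zero]
    · have hlt := Γ.parent_lt (k + 1) k.succ_pos
      have hrank := ih _ hlt fun j hj => hp j (hj.trans hlt)
      have := Classical.epsilon_spec (exists_isGoodPick (T := T) (y := y) h hlim hε hκ
        (hp k k.lt_succ_self) (pickMap Γ x T y g ε κ p k)
        ((Γ.rank_lt _ k.succ_pos).trans_le hrank))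
      rw [pickMap, RankedTree.greedyMap_succ]
      exact this.rank_le

theorem isGoodPick_pickMap (h : IsTreeBasis Γ x δ)
    (hlim : ∀ n, 0 < Γ.rank n → ∃ l : Filter ℕ, l.NeBot ∧ l ≤ Γ.childFilter n ∧
      ∀ z, Tendsto (fun c => g c z) l (𝓝 (g n z)))
    (hε : ∀ k, 0 < ε k) (hκ : 0 < κ) {p : ℕ → FirstMove 𝕜 Y} {k : ℕ}
    (hp : ∀ j ≤ k, ∀ d ∈ (p j).F, 0 < d.2) :
    IsGoodPick Γ x T y g ε κ p k (pickMap Γ x T y g ε κ p k)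
      (pickMap Γ x T y g ε κ p (Γ.parent (k + 1))) (pickMap Γ x T y g ε κ p (k + 1)) := by
  have hlt := Γ.parent_lt (k + 1) k.succ_pos
  have hrank := rank_le_rank_pickMap (T := T) (y := y) (p := p) h hlim hε hκ
    (Γ.parent (k + 1)) fun j hj => hp j (by omega)
  have := Classical.epsilon_spec (exists_isGoodPick (T := T) (y := y) h hlim hε hκ
    (hp k le_rfl) (pickMap Γ x T y g ε κ p k) ((Γ.rank_lt _ k.succ_pos).trans_le hrank))
  have hsucc : pickMap Γ x T y g ε κ p (k + 1) = Classical.epsilon (IsGoodPick Γ x T y g ε κ p k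
      (pickMap Γ x T y g ε κ p k) (pickMap Γ x T y g ε κ p (Γ.parent (k + 1)))) :=
    RankedTree.greedyMap_succ _ _ _
  rw [hsucc]
  exact this

variable (y) in
theorem exists_norm_sub_proj_lt (i : ℕ) (z : Y) {ρ : ℝ} (hρ : 0 < ρ) :
    ∃ l, i < l ∧ ‖z - y.proj l z‖ < ρ := by
  have h1 := (Metric.tendsto_nhds.1 (SchauderBasis.tendsto_proj y z)) ρ hρ
  obtain ⟨l, hl, hd⟩ := ((eventually_gt_atTop i).and h1).exists
  exact ⟨l, hl, by rwa [← dist_eq_norm, dist_comm]⟩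

open Classical in
variable (x T y g κ) in
/-- The answer of the second player in turn `k` if the images of the nodes are given by `φ`; the
approximation of the chosen basis vector is good up to `ρ / 2` on the right. -/
noncomputable def reply (ρ : ℝ) (k : ℕ) (φ : ℕ → ℕ) (p : FirstMove 𝕜 Y) : SecondMove 𝕜 Y :=
  let z : Y := T (x (φ (k + 1) - 1))
  let l : ℕ := Classical.epsilon fun l => p.i < l ∧ ‖z - y.proj l z‖ < ρ / 2
  { l := l
    M := {φ (k + 1) - 1}
    w := fun _ => y.proj l z - y.proj p.i z
    G := (Finset.range (k + 2)).image fun m => (g (φ m) - g 0, κ * (1 / 2) ^ (k + 1)) }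

theorem reply_congr {ρ : ℝ} {k : ℕ} {φ φ' : ℕ → ℕ} (hφ : ∀ n ≤ k + 1, φ n = φ' n)
    (p : FirstMove 𝕜 Y) : reply x T y g κ ρ k φ p = reply x T y g κ ρ k φ' p := by
  classical
  have hG : Set.EqOn (fun m => (g (φ m) - g 0, κ * (1 / 2 : ℝ) ^ (k + 1)))
      (fun m => (g (φ' m) - g 0, κ * (1 / 2) ^ (k + 1))) (Finset.range (k + 2)) := fun m hm => by
    have : m < k + 2 := by simpa using hm
    simp only [hφ m (by omega)]
  simp only [reply, hφ (k + 1) le_rfl, Finset.image_congr hG]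

variable (Γ x T y g ε κ) in
/-- The strategy that answers by the nodes of `pickMap`. -/
noncomputable def pickStrategy : Strategy 𝕜 Y := fun k q =>
  reply x T y g κ (min (ε (k + 1)) ‖(T.symm : E →L[𝕜] X)‖⁻¹) k
    -- The finite history is prolonged by repeating its last move; only the moves up to turn `k`
    -- influence the answer.
    (pickMap Γ x T y g ε κ fun j => q ⟨min j k, Nat.lt_succ_of_le (min_le_right j k)⟩)
    (q (Fin.last k))

theorem pickStrategy_answer (p : ℕ → FirstMove 𝕜 Y) (k : ℕ) :
    (pickStrategy Γ x T y g ε κ).answer p k =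
      reply x T y g κ (min (ε (k + 1)) ‖(T.symm : E →L[𝕜] X)‖⁻¹) k
        (pickMap Γ x T y g ε κ p) (p k) :=
  reply_congr (pickMap_congr fun j hj => by simp [min_eq_left hj]) _

/-- Legality of each answer follows from the good pick. After a full game `φ` is an embedding, and
what remains is that all `g (φ m) - g 0` are uniformly small on the span of the first player's
vectors. -/
theorem pickStrategy_isWinning [CompleteSpace Y] (h : IsTreeBasis Γ x δ)
    (hg : ∀ n, ‖g n‖ ≤ ‖(T.symm : E →L[𝕜] X)‖) (hgT : ∀ n f, g n (T f) = δ n f)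
    (hlim : ∀ n, 0 < Γ.rank n → ∃ l : Filter ℕ, l.NeBot ∧ l ≤ Γ.childFilter n ∧
      ∀ z, Tendsto (fun c => g c z) l (𝓝 (g n z)))
    (hε : ∀ k, 0 < ε k) (hκ : 0 < κ) {K : ℝ} (hK : ∀ n, ‖y.proj n‖ ≤ K)
    (hκε : ‖(T : X →L[𝕜] E)‖ * (12 * K * κ) ≤ ε 0) :
    (pickStrategy Γ x T y g ε κ).IsWinning 2 1 x y T ε := by
  classical
  intro p
  set σ := pickStrategy Γ x T y g ε κ with hσ
  set φ := pickMap Γ x T y g ε κ p with hφdef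
  have hr := symm_norm_pos x T h
  have hans : ∀ k, σ.answer p k =
      reply x T y g κ (min (ε (k + 1)) ‖(T.symm : E →L[𝕜] X)‖⁻¹) k φ (p k) :=
    pickStrategy_answer p
  have hpick : ∀ k, (∀ j ≤ k, FirstLegal y (σ.before p j) (p j)) →
      IsGoodPick Γ x T y g ε κ p k (φ k) (φ (Γ.parent (k + 1))) (φ (k + 1)) := fun k hk =>
    isGoodPick_pickMap h hlim hε hκ fun j hj => (hk j hj).2.1
  have hM : ∀ k, (σ.answer p k).M = {φ (k + 1) - 1} := fun k => by rw [hans]; rfl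
  have hl : ∀ k, (p k).i < (σ.answer p k).l ∧
      ‖(T (x (φ (k + 1) - 1)) : Y) - y.proj (σ.answer p k).l (T (x (φ (k + 1) - 1)))‖ <
        min (ε (k + 1)) ‖(T.symm : E →L[𝕜] X)‖⁻¹ / 2 := fun k => by
    rw [hans]
    exact Classical.epsilon_spec (exists_norm_sub_proj_lt y (p k).i
      (T (x (φ (k + 1) - 1)) : Y) (half_pos (lt_min (hε (k + 1)) (inv_pos.2 hr))))
  refine ⟨fun k hk => ?_, fun hlegal => ?_⟩
  · have hgood := hpick k hk
    set z : Y := (T (x (φ (k + 1) - 1)) : Y) with hz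
    set w : Y := y.proj (σ.answer p k).l z - y.proj (p k).i z with hw
    have hw_eq : ∀ m, (σ.answer p k).w m = w := fun m => by rw [hw, hans]; rfl
    have hzw : ‖z - w‖ < min (ε (k + 1)) ‖(T.symm : E →L[𝕜] X)‖⁻¹ := by
      have h1 := (hl k).2
      have h2 := hgood.norm_proj_lt
      have h3 : z - w = (z - y.proj (σ.answer p k).l z) + y.proj (p k).i z := by
        rw [hw]
        abel
      rw [h3]
      refine (norm_add_le _ _).trans_lt ?_
      linarith
    have hz1 : 1 ≤ ‖(T.symm : E →L[𝕜] X)‖ * ‖z‖ := one_le_symm_norm_mul T h _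
    refine ⟨(hl k).1, ?_, ?_, ?_, ?_, ?_, ?_, ?_⟩
    · rw [hM]
      exact Finset.singleton_nonempty _
    · rcases k with _ | k
      · intro m hm
        exact absurd hm (Finset.notMem_empty m)
      · intro m hm m' hm'
        change m ∈ (σ.answer p k).M at hm
        rw [hM, Finset.mem_singleton] at hm hm'
        have h1 := (hpick k fun j hj => hk j (hj.trans k.le_succ)).lt
        have h2 := hgood.lt
        omega
    · intro m _
      rw [hw_eq]
      refine ⟨fun hw0 => ?_, proj_sub_proj_mem_window y (hl k).1.le z⟩
      rw [hw0, sub_zero] at hzw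
      have := hzw.trans_le (min_le_right _ _)
      -- If `w` were zero then `‖z‖ < ‖T⁻¹‖⁻¹`, against `‖T⁻¹‖ * ‖z‖ ≥ 1`; hence the minimum in the
      -- approximation bound.
      have h5 := (lt_inv_mul_iff₀ hr).1 (this.trans_eq (mul_one _).symm)
      exact (hz1.trans_lt h5).false
    · intro m hm m' hm' hlt
      rw [hM, Finset.mem_singleton] at hm hm'
      omega
    · rw [hM, Finset.sum_singleton, hw_eq]
      exact hzw.trans_le (min_le_left _ _)
    · intro d hd v hv hv0
      rw [hM, Finset.coe_singleton, Set.image_singleton, Submodule.mem_span_singleton] at hv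
      obtain ⟨a, rfl⟩ := hv
      have ha : 0 < ‖a‖ := norm_pos_iff.2 fun h0 => hv0 (by rw [h0, zero_smul])
      have h1 := hgood.small d hd
      change ‖d.1 z‖ * _ < d.2 at h1
      change ‖d.1 (a • z)‖ < d.2 * ‖a • z‖
      rw [map_smul, norm_smul, norm_smul]
      have hd2 : 0 < d.2 := (mul_nonneg (norm_nonneg _) hr.le).trans_lt h1
      have h2 : ‖d.1 z‖ < d.2 * ‖z‖ := by
        have h3 : d.2 ≤ d.2 * (‖(T.symm : E →L[𝕜] X)‖ * ‖z‖) := le_mul_of_one_le_right hd2.le hz1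
        refine lt_of_mul_lt_mul_right ?_ hr.le
        calc _ < d.2 := h1
          _ ≤ _ := h3
          _ = _ := by ring
      calc ‖a‖ * ‖d.1 z‖ < ‖a‖ * (d.2 * ‖z‖) := by gcongr
        _ = _ := by ring
    · intro c hc
      rw [hans] at hc
      obtain ⟨m, -, rfl⟩ := Finset.mem_image.1 hc
      positivity
  · have hgood := fun k => hpick k fun j _ => hlegal j
    have hφ : Γ.IsEmbedding φ := by
      refine ⟨RankedTree.greedyMap_zero _ _, strictMono_nat_of_lt_succ fun k => (hgood k).lt, ?_⟩
      rintro (_ | k) hk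
      · exact absurd hk (lt_irrefl 0)
      · exact (hgood k).parent_eq
    have hMrange : (⋃ k, ((σ.answer p k).M : Set ℕ)) = Set.range fun k => φ (k + 1) - 1 := by
      ext m
      simp [hM, eq_comm]
    have hmono : StrictMono fun k => φ (k + 1) - 1 := strictMono_nat_of_lt_succ fun k => by
      have h1 := (hgood k).lt
      have h2 := (hgood (k + 1)).lt
      omega
    let L : ℕ → ℕ := fun k => (σ.before p k).l
    have hLI : ∀ k, L k ≤ (p k).i := fun k => (hlegal k).1
    have hIL : ∀ k, (p k).i ≤ L (k + 1) := fun k => (hl k).1.le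
    -- Nodes up to `k` were mapped before turn `k`, so the demands made in the preceding turn apply.
    -- For the root the difference is zero.
    have hannounced : ∀ k m, m ≤ k → ∀ β ∈ Submodule.span 𝕜 ((p k).b : Set Y),
        ‖(g (φ m) - g 0) β‖ ≤ κ * (1 / 2) ^ k * ‖β‖ := by
      intro k m hmk β hβ
      rcases Nat.eq_zero_or_pos m with rfl | hm
      · rw [hφ.map_zero, sub_self]
        simp only [zero_apply, norm_zero]
        positivity
      · obtain ⟨k, rfl⟩ := Nat.exists_eq_add_of_lt (hm.trans_le hmk)
        rw [zero_add] at *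
        by_cases hβ0 : β = 0
        · simp [hβ0]
        · have hG : (g (φ m) - g 0, κ * (1 / 2) ^ (k + 1)) ∈ (σ.answer p k).G := by
            rw [hans]
            exact Finset.mem_image.2 ⟨m, Finset.mem_range.2 (by omega), rfl⟩
          exact ((hlegal (k + 1)).2.2.2 _ hG β hβ hβ0).le
    have hconv : ∀ n k, k ≤ n → ∀ β ∈ Submodule.span 𝕜 ((p k).b : Set Y),
        ‖(g (φ (n + 1)) - g (φ (Γ.parent (n + 1)))) β‖ ≤ κ * (1 / 2) ^ n * ‖β‖ :=
      fun n k hkn => (hgood n).close k hkn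
    -- From a node mapped in turn `k` or later, go back to its parent at the cost given by `hconv`,
    -- until a node covered by `hannounced` is reached.
    have hsmall : ∀ k m, ∀ β ∈ Submodule.span 𝕜 ((p k).b : Set Y),
        ‖(g (φ m) - g 0) β‖ ≤
          (κ * (1 / 2) ^ k + ∑ j ∈ Finset.Ico k m, κ * (1 / 2) ^ j) * ‖β‖ := by
      intro k m
      induction m using Nat.strong_induction_on with
      | _ m ih =>
        intro β hβ
        rcases le_or_gt m k with hmk | hkm
        · rw [Finset.Ico_eq_empty_of_le hmk, Finset.sum_empty, add_zero]
          exact hannounced k m hmk β hβ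
        · obtain ⟨n, rfl⟩ := Nat.exists_eq_add_of_lt hkm
          have hlt := Γ.parent_lt (k + n + 1) (Nat.succ_pos _)
          have h1 := ih _ hlt β hβ
          have h2 := hconv (k + n) k (Nat.le_add_right _ _) β hβ
          have h3 : (g (φ (k + n + 1)) - g 0) β = (g (φ (k + n + 1)) -
              g (φ (Γ.parent (k + n + 1)))) β + (g (φ (Γ.parent (k + n + 1))) - g 0) β := by
            simp
          have h4 : ∑ j ∈ Finset.Ico k (Γ.parent (k + n + 1)), κ * (1 / 2 : ℝ) ^ j ≤
              ∑ j ∈ Finset.Ico k (k + n), κ * (1 / 2) ^ j := by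
            refine Finset.sum_le_sum_of_subset_of_nonneg
              (Finset.Ico_subset_Ico_right (by omega)) fun _ _ _ => by positivity
          rw [Finset.sum_Ico_succ_top (Nat.le_add_right _ _), h3]
          refine (norm_add_le _ _).trans ((add_le_add h2 h1).trans ?_)
          rw [← add_mul]
          gcongr ?_ * _
          linarith
    -- `3 = 1 + 2`: one unit from the demand, two from the geometric tail. With the factor `4 * K`
    -- of the windows this yields `12 * K * κ`.
    have hsmall' : ∀ m k, ∀ β ∈ Submodule.span 𝕜 ((p k).b : Set Y),
        ‖(g (φ m) - g 0) β‖ ≤ 3 * κ * (1 / 2) ^ k * ‖β‖ := by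
      intro m k β hβ
      refine (hsmall k m β hβ).trans ?_
      have := geom_sum_Ico_le_of_lt_one (x := (1 / 2 : ℝ)) (m := k) (n := m)
        (by norm_num) (by norm_num)
      gcongr ?_ * _
      rw [← Finset.mul_sum]
      have h2 := mul_le_mul_of_nonneg_left this hκ.le
      have h3 : κ * ((1 / 2 : ℝ) ^ k / (1 - 1 / 2)) = 2 * κ * (1 / 2) ^ k := by
        norm_num
        ring
      linarith
    refine ⟨⟨_, hmono, hMrange.symm, 1, 1, one_pos, one_pos, by norm_num, fun s a => ?_⟩, ?_⟩
    · rw [h.norm_sum_comp hφ s a, one_mul]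
      exact ⟨le_rfl, le_rfl⟩
    · refine exists_projection h hφ hgT hg (b := fun k => (p k).b) hconv (fun n z hz => ?_) ?_ rfl
      · have h1 := norm_apply_le_of_mem_span_iUnion y hLI hIL (fun k => (hlegal k).2.2.1) hK
          (by positivity) (hsmall' n) hz
        calc _ ≤ ‖(T : X →L[𝕜] E)‖ * (4 * K * (3 * κ) * ‖z‖) := by gcongr
          _ = ‖(T : X →L[𝕜] E)‖ * (12 * K * κ) * ‖z‖ := by ring
          _ ≤ _ := by gcongr
      · rw [hMrange, ← Set.range_comp]
        rfl

end ReproducibleGame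

/-! ### Choice of the constant and conclusion. -/

open ReproducibleGame in
theorem IsTreeBasis.isTwoPlayerComplementablyReproducible {𝕜 : Type u} [RCLike 𝕜] {X : Type w}
    [NormedAddCommGroup X] [NormedSpace 𝕜 X] {Γ : RankedTree} {x : ℕ → X}
    {δ : ℕ → StrongDual 𝕜 X} (h : IsTreeBasis Γ x δ) :
    IsTwoPlayerComplementablyReproducible.{u, v, w} 𝕜 2 1 x := by
  refine ⟨h.exists_schauderBasis, fun Y _ _ _ y E T ε hε => ?_⟩
  obtain ⟨g, hg, hgT, hlim⟩ := h.exists_extensions T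
  obtain ⟨K, hK⟩ := SchauderBasis.exists_norm_proj_le y
  have hK0 : 0 ≤ K := (norm_nonneg _).trans (hK 0)
  set A := ‖(T : X →L[𝕜] E)‖ * (12 * K) with hA
  have hA0 : 0 ≤ A := by positivity
  -- This `κ` makes `A * κ ≤ ε 0`; the `+ 1` avoids a separate case `A = 0`.
  have hκ : 0 < ε 0 / (A + 1) := div_pos (hε 0) (by positivity)
  refine ⟨_, pickStrategy_isWinning h hg hgT hlim hε hκ hK ?_⟩
  calc _ = A * ε 0 / (A + 1) := by rw [hA]; ring
    _ ≤ ε 0 := by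
      rw [div_le_iff₀ (by positivity)]
      nlinarith [hε 0]

theorem proposition2p5 {𝕜 : Type u} [RCLike 𝕜] (α : Ordinal.{0})
    (hα : α.card ≤ Cardinal.aleph0) (x : ℕ → C0 𝕜 α) (hx : IsStandardBasisC0 𝕜 α x) :
    IsTwoPlayerComplementablyReproducible.{u, v, max 1 u} 𝕜 2 1 x := by
  obtain ⟨Γ, δ, h⟩ := exists_isTreeBasis hx
  exact h.isTwoPlayerComplementablyReproducible
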